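/- **Conventions.** $\mathbb P^m$ denotes complex projective space. A camera is a real $3\times 4$ matrix $P$ of rank $3$; its center is the point of $\mathbb P^3$ given by its kernel. Let $n\ge 2$. A configuration $(\mathbf P,X)$ consists of $n$ cameras $\mathbf P=(P_1,\dots,P_n)$ with pairwise distinct centers and a set $X\subseteq\mathbb P^3$. A point $x$ has image $u\in\mathbb P^2$ under $P_i$ if $u=P_i(x)$, where the center of $P_i$ is allowed to have any image under $P_i$ (closure of the graph of the projection). $(\mathbf P,X)$ is a reconstruction of $S\subseteq(\mathbb P^2)^n$ if every $s\in S$ is a tuple of images of some $x\in X$, and every $x\in X$ has a tuple of images in $S$. Configurations $(\mathbf P,X)$, $(\mathbf Q,Y)$ are equivalent if some $H\in \mathrm{PGL}(4)$ satisfies $H(X)=Y$ and $P_iH^{-1}=Q_i$ (up to scale) for all $i$; they are conjugate if they are nonequivalent reconstructions of the same set $S$, and non-trivially conjugate if moreover, for all $i\ne j$, the fundamental matrices of $(P_i,P_j)$ and $(Q_i,Q_j)$ differ (as matrices up to scale). A configuration is (non-trivially) critical if it has a (non-trivially) conjugate configuration. For curves $C,D$ we say that $(\mathbf P,C)$ and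 $(\mathbf Q,D)$ are conjugate along the curves if they are non-trivially conjugate, and for every $X\subseteq C$ there is $Y\subseteq D$, and for every $Y\subseteq D$ there is $X\subseteq C$, such that $(\mathbf P,X)$ and $(\mathbf Q,Y)$ are non-trivially conjugate. All curves are real: a rational quartic is the image of $\mathbb P^1$ under four linearly independent real binary quartic forms without common zero (so it spans $\mathbb P^3$); it is smooth if this parametrization is a closed embedding, and singular otherwise. A twisted cubic is the image of $\mathbb P^1$ under four linearly independent real binary cubic forms. A secant line of a twisted cubic is a line spanned by two distinct (possibly complex) points of it, or a tangent line of it. **Proposition.** Let $n\ge2$. 1. Let $C$ be a smooth rational quartic and $\mathbf P$ an $n$-tuple of cameras with centers on $C$. Then $(\mathbf P,X)$ is non-trivially critical for every $X\subseteq C$. Moreover there are a twisted cubic $D$, a line $L$ with $L\cap D=\emptyset$ and cameras $\mathbf Q$ with centers on $L$ such that $(\mathbf P,C)$ and $(\mathbf Q,D)$ are conjugate along the curves. 2. Let $D$ be a twisted cubic, $L$ a line with $L\cap D=\emptyset$ and $\mathbf Q$ an $n$-tuple of cameras with centers on $L$. Then $(\mathbf Q,Y)$ is non-trivially critical for every $Y\subseteq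 D$. Moreover there are a smooth rational quartic $C$ and cameras $\mathbf P$ with centers on $C$ such that $(\mathbf Q,D)$ and $(\mathbf P,C)$ are conjugate along the curves. 3. Let $C$ be a singular rational quartic and $\mathbf P$ an $n$-tuple of cameras with centers on $C$. Then $(\mathbf P,X)$ is non-trivially critical for every $X\subseteq C$. If moreover no camera center is an isolated real point of $C$ (a node with complex conjugate branches), i.e. all centers are images of real points of $\mathbb P^1$, then there are a twisted cubic $D$, a secant line $L$ of $D$ and cameras $\mathbf Q$ with centers on $L$, at most one of them on $D$, such that $(\mathbf P,C)$ and $(\mathbf Q,D)$ are conjugate along the curves. 4. Let $D$ be a twisted cubic, $L$ a secant line of $D$ and $\mathbf Q$ an $n$-tuple of cameras with centers on $L$. Then $(\mathbf Q,Y)$ is critical for every $Y\subseteq D$. If $n\le3$ or at most one camera center lies on $D$, then $(\mathbf Q,Y)$ is non-trivially critical for every $Y\subseteq D$. If at most one camera center lies on $D$, then there are a singular rational quartic $C$ and cameras $\mathbf P$ whose centers are images of real points of $\mathbb P^1$ on $C$, such that $(\mathbf Q,D)$ and $(\mathbf P,C)$ are conjugate along the curves. -/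

import Mathlib

open scoped LinearAlgebra.Projectivization

noncomputable section

/-- Complex projective 3-space (space points). -/
abbrev P3 : Type := ℙ ℂ (Fin 4 → ℂ)

/-- Complex projective plane (image points). -/
abbrev P2 : Type := ℙ ℂ (Fin 3 → ℂ)

/-! ### Cameras -/

/-- A (real projective pinhole) camera: a real `3 × 4` matrix of full rank. -/
structure Camera where
  mat : Matrix (Fin 3) (Fin 4) ℝ
  rank_eq : mat.rank = 3

/-- The linear map `ℂ⁴ → ℂ³` given by the camera matrix. -/
def Camera.toLin (P : Camera) : (Fin 4 → ℂ) →ₗ[ℂ] (Fin 3 → ℂ) :=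
  (P.mat.map Complex.ofReal).mulVecLin

theorem Camera.exists_ker (P : Camera) : ∃ v : Fin 4 → ℂ, v ≠ 0 ∧ P.toLin v = 0 := by
  have h : P.toLin.ker ≠ ⊥ := LinearMap.ker_ne_bot_of_finrank_lt (by simp)
  obtain ⟨v, hv, h0⟩ := Submodule.exists_mem_ne_zero_of_ne_bot h
  exact ⟨v, h0, hv⟩

/-- The camera center: the point of `ℙ³` given by the kernel of the camera matrix
(a line in `ℂ⁴`, see `Camera.toLin_eq_zero_iff`). -/
def Camera.center (P : Camera) : P3 :=
  Projectivization.mk ℂ P.exists_ker.choose P.exists_ker.choose_spec.1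

/-- An `n`-tuple of cameras with pairwise distinct camera centers. -/
structure CameraTuple (n : ℕ) where
  cam : Fin n → Camera
  distinct : Function.Injective fun i => (cam i).center

/-- All camera centers lie in `C`. -/
def CameraTuple.CentersIn {n : ℕ} (P : CameraTuple n) (C : Set P3) : Prop :=
  ∀ i, (P.cam i).center ∈ C

theorem Camera.finrank_ker (P : Camera) : Module.finrank ℂ P.toLin.ker = 1 := by
  have h3 : (P.mat.map Complex.ofReal).rank = 3 := by
    have hsurj : Function.Surjective P.mat.mulVecLin := by
      rw [← LinearMap.range_eq_top]
      apply Submodule.eq_top_of_finrank_eq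
      have := P.rank_eq
      rw [Matrix.rank] at this
      simpa using this
    choose g hg using fun b : Fin 3 => hsurj (Pi.single b 1)
    have hmul : P.mat * (Matrix.of fun a b => g b a) = 1 := by
      ext a b
      have := congrFun (hg b) a
      simpa [Matrix.mul_apply, Matrix.mulVec, dotProduct, Matrix.one_apply, Pi.single_apply]
        using this
    have hmulC := congrArg (fun M : Matrix (Fin 3) (Fin 3) ℝ => M.map Complex.ofRealHom) hmul
    simp only [Matrix.map_mul] at hmulC
    apply le_antisymm
    · simpa using Matrix.rank_le_height (P.mat.map Complex.ofReal)
    · have h1 := Matrix.rank_mul_le_left (P.mat.map Complex.ofRealHom)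
        ((Matrix.of fun a b => g b a).map Complex.ofRealHom)
      rw [hmulC, Matrix.map_one _ (map_zero _) (map_one _), Matrix.rank_one] at h1
      rw [Fintype.card_fin] at h1
      exact h1
  have h4 := LinearMap.finrank_range_add_finrank_ker (P.mat.map Complex.ofReal).mulVecLin
  rw [Matrix.rank] at h3
  rw [h3, Module.finrank_fin_fun] at h4
  change Module.finrank ℂ (P.mat.map Complex.ofReal).mulVecLin.ker = 1
  omega

theorem Camera.toLin_eq_zero_iff (P : Camera) (x : P3) : P.toLin x.rep = 0 ↔ x = P.center := by
  have hc := P.exists_ker.choose_spec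
  constructor
  · intro hx
    have h1 := P.finrank_ker
    obtain ⟨c, hcx⟩ := (finrank_eq_one_iff_of_nonzero' (⟨_, hc.2⟩ : P.toLin.ker)
      (by simpa [Subtype.ext_iff] using hc.1)).1 h1 ⟨x.rep, hx⟩
    rw [← x.mk_rep, Camera.center, Projectivization.mk_eq_mk_iff']
    exact ⟨c, congrArg Subtype.val hcx⟩
  · rintro rfl
    obtain ⟨a, ha⟩ := Projectivization.exists_smul_eq_mk_rep ℂ _ hc.1
    rw [Camera.center, ← ha]
    have h2 := hc.2
    simp only [Units.smul_def, map_smul, h2, smul_zero]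

/-! ### Images, reconstructions, conjugate and critical configurations

A configuration is a tuple of cameras `P` together with a set `X` of space points. -/

/-- `u` is an image of `x` under `P`.  If `x` is not the camera center this says `u = P(x)`;
the camera center itself is allowed to have any image (closure of the graph of the projection). -/
def Camera.Sees (P : Camera) (x : P3) (u : P2) : Prop :=
  P.toLin x.rep ∈ u.submodule

/-- `(P, X)` is a reconstruction of the set `S ⊆ (ℙ²)ⁿ`: the points of `S` are exactly images,
under the joint camera map, of the points of `X`. -/
def IsReconstruction {n : ℕ} (P : CameraTuple n) (X : Set P3) (S : Set (Fin n → P2)) : Prop :=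
  (∀ s ∈ S, ∃ x ∈ X, ∀ i, (P.cam i).Sees x (s i)) ∧
  (∀ x ∈ X, ∃ s ∈ S, ∀ i, (P.cam i).Sees x (s i))

/-- Two configurations are equivalent if some `H ∈ PGL(4)` satisfies `H(X) = Y` and
`Pᵢ H⁻¹ = Qᵢ` (as projective maps, that is up to a nonzero scalar) for all `i`. -/
def Equivalent {n : ℕ} (P : CameraTuple n) (X : Set P3) (Q : CameraTuple n) (Y : Set P3) : Prop :=
  ∃ H : (Fin 4 → ℂ) ≃ₗ[ℂ] (Fin 4 → ℂ),
    Projectivization.map H.toLinearMap H.injective '' X = Y ∧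
    ∀ i, ∃ c : ℂ, c ≠ 0 ∧ ∀ v, (P.cam i).toLin v = c • (Q.cam i).toLin (H v)

/-- Conjugate configurations: nonequivalent reconstructions of the same set. -/
def Conjugate {n : ℕ} (P : CameraTuple n) (X : Set P3) (Q : CameraTuple n) (Y : Set P3) : Prop :=
  (∃ S, IsReconstruction P X S ∧ IsReconstruction Q Y S) ∧ ¬ Equivalent P X Q Y

/-- A configuration is critical if it has a conjugate configuration. -/
def IsCritical {n : ℕ} (P : CameraTuple n) (X : Set P3) : Prop :=
  ∃ (Q : CameraTuple n) (Y : Set P3), Conjugate P X Q Y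

/-- The bilinear form `xᵀ F y = det [P x 0; Q 0 y]` of a pair of cameras. -/
def fundamentalForm (P Q : Camera) (x y : Fin 3 → ℝ) : ℝ :=
  Matrix.det
    !![P.mat 0 0, P.mat 0 1, P.mat 0 2, P.mat 0 3, x 0, 0;
       P.mat 1 0, P.mat 1 1, P.mat 1 2, P.mat 1 3, x 1, 0;
       P.mat 2 0, P.mat 2 1, P.mat 2 2, P.mat 2 3, x 2, 0;
       Q.mat 0 0, Q.mat 0 1, Q.mat 0 2, Q.mat 0 3, 0, y 0;
       Q.mat 1 0, Q.mat 1 1, Q.mat 1 2, Q.mat 1 3, 0, y 1;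
       Q.mat 2 0, Q.mat 2 1, Q.mat 2 2, Q.mat 2 3, 0, y 2]

/-- The fundamental matrix of a pair of cameras. -/
def fundamentalMatrix (P Q : Camera) : Matrix (Fin 3) (Fin 3) ℝ :=
  Matrix.of fun a b => fundamentalForm P Q (Pi.single a 1) (Pi.single b 1)

/-- No pair of cameras of `P` has the same fundamental matrix (up to scale) as the
corresponding pair of cameras of `Q`. -/
def FundamentalMatricesDiffer {n : ℕ} (P Q : CameraTuple n) : Prop :=
  ∀ i j, i ≠ j → ¬ ∃ c : ℝ, c ≠ 0 ∧
    fundamentalMatrix (Q.cam i) (Q.cam j) = c • fundamentalMatrix (P.cam i) (P.cam j)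

/-- Conjugate configurations all of whose corresponding fundamental matrices differ. -/
def NonTriviallyConjugate {n : ℕ} (P : CameraTuple n) (X : Set P3)
    (Q : CameraTuple n) (Y : Set P3) : Prop :=
  Conjugate P X Q Y ∧ FundamentalMatricesDiffer P Q

/-- A non-trivial critical configuration. -/
def IsNonTriviallyCritical {n : ℕ} (P : CameraTuple n) (X : Set P3) : Prop :=
  ∃ (Q : CameraTuple n) (Y : Set P3), NonTriviallyConjugate P X Q Y

/-- The configurations with cameras `P` and points on `C` are conjugate to the configurations with
cameras `Q` and points on `D`: this holds for the full point sets `C` and `D`, and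
for every set of points on one of them there is a conjugate set of points on the other. -/
def ConjugateAlong {n : ℕ} (P : CameraTuple n) (C : Set P3)
    (Q : CameraTuple n) (D : Set P3) : Prop :=
  NonTriviallyConjugate P C Q D ∧
  (∀ X ⊆ C, ∃ Y ⊆ D, NonTriviallyConjugate P X Q Y) ∧
  (∀ Y ⊆ D, ∃ X ⊆ C, NonTriviallyConjugate P X Q Y)

/-! ### Real rational curves in `ℙ³` -/

/-- All monomials of degree `d` in two variables. -/
def veronese (d : ℕ) (z : Fin 2 → ℂ) : Fin (d + 1) → ℂ :=
  fun k => z 0 ^ (k : ℕ) * z 1 ^ (d - (k : ℕ))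

/-- The map `ℂ² → ℂ⁴` given by four real binary forms of degree `d`; the rows of `A` are their
coefficients. -/
def paramMap {d : ℕ} (A : Matrix (Fin 4) (Fin (d + 1)) ℝ) (z : Fin 2 → ℂ) : Fin 4 → ℂ :=
  (A.map Complex.ofReal).mulVec (veronese d z)

/-- The (complex) curve in `ℙ³` parametrized by `ℙ¹` through the forms `A`. -/
def curve {d : ℕ} (A : Matrix (Fin 4) (Fin (d + 1)) ℝ) : Set P3 :=
  {x | ∃ z : Fin 2 → ℂ, z ≠ 0 ∧ ∃ h : paramMap A z ≠ 0, x = Projectivization.mk ℂ (paramMap A z) h}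

/-- The image of the real projective line under the parametrization. -/
def realBranch {d : ℕ} (A : Matrix (Fin 4) (Fin (d + 1)) ℝ) : Set P3 :=
  {x | ∃ z : Fin 2 → ℝ, z ≠ 0 ∧ ∃ h : paramMap A (fun i => (z i : ℂ)) ≠ 0,
    x = Projectivization.mk ℂ (paramMap A (fun i => (z i : ℂ))) h}

/-- A real rational quartic spanning `ℙ³`: four linearly independent binary quartic forms without
common zero.  (Spanning `ℙ³` forces the parametrization to be birational onto its image.) -/
def IsRationalQuartic (A : Matrix (Fin 4) (Fin (4 + 1)) ℝ) : Prop :=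
  A.rank = 4 ∧ ∀ z : Fin 2 → ℂ, z ≠ 0 → paramMap A z ≠ 0

/-- The parametrization `ℙ¹ → ℙ³` is a closed embedding: it is injective and immersive
(for a homogeneous map, the latter means that its differential is injective off the origin). -/
def IsEmbeddedCurve {d : ℕ} (A : Matrix (Fin 4) (Fin (d + 1)) ℝ) : Prop :=
  (∀ z w : Fin 2 → ℂ, z ≠ 0 → w ≠ 0 →
    (∃ c : ℂ, c ≠ 0 ∧ paramMap A z = c • paramMap A w) → ∃ c : ℂ, c ≠ 0 ∧ z = c • w) ∧
  (∀ z : Fin 2 → ℂ, z ≠ 0 → Function.Injective (fderiv ℂ (paramMap A) z))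

/-- A smooth rational quartic. -/
def IsSmoothRationalQuartic (A : Matrix (Fin 4) (Fin (4 + 1)) ℝ) : Prop :=
  IsRationalQuartic A ∧ IsEmbeddedCurve A

/-- A singular rational quartic. -/
def IsSingularRationalQuartic (A : Matrix (Fin 4) (Fin (4 + 1)) ℝ) : Prop :=
  IsRationalQuartic A ∧ ¬ IsEmbeddedCurve A

/-- A twisted cubic: four linearly independent binary cubic forms. -/
def IsTwistedCubic (B : Matrix (Fin 4) (Fin (3 + 1)) ℝ) : Prop :=
  B.rank = 4

/-! ### Lines -/

/-- The points of `ℙ³` on the linear subspace given by `L`. -/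
def linePoints (L : Submodule ℂ (Fin 4 → ℂ)) : Set P3 :=
  {x | x.submodule ≤ L}

/-- `L` is a line in `ℙ³`. -/
def IsLine (L : Submodule ℂ (Fin 4 → ℂ)) : Prop :=
  Module.finrank ℂ L = 2

/-- `L` is spanned by two points of the curve, or is tangent to it. -/
def IsSecantLine {d : ℕ} (B : Matrix (Fin 4) (Fin (d + 1)) ℝ)
    (L : Submodule ℂ (Fin 4 → ℂ)) : Prop :=
  IsLine L ∧
  ((∃ z w : Fin 2 → ℂ, LinearIndependent ℂ ![z, w] ∧
      L = Submodule.span ℂ {paramMap B z, paramMap B w}) ∨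
   (∃ z : Fin 2 → ℂ, z ≠ 0 ∧
      L = LinearMap.range (fderiv ℂ (paramMap B) z).toLinearMap))

/-- At most one of the camera centers lies in `C`. -/
def CameraTuple.AtMostOneCenterIn {n : ℕ} (P : CameraTuple n) (C : Set P3) : Prop :=
  ∀ i j, (P.cam i).center ∈ C → (P.cam j).center ∈ C → i = j

end

/-!
A rational quartic with coefficients `A` is the projection, from the vertex `k` spanning the kernel
of `A`, of the rational normal quartic with points `v z` in `ℙ⁴`.  It is a rational curve without
base points iff `k` is off the normal curve, and it is embedded iff `k` lies on no chord and no
tangent line.  Contraction with the linear form vanishing at `w` projects the normal quartic from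
`v w` to the normal cubic.  A camera `P` with center at the point with parameter `w` of the quartic
and a camera `Q` with `P A = Q B (contraction with w)` therefore give the same image of the quartic
`A` and the twisted cubic `B`, and `Q` has its center at `B` of the contraction of `k` with `w`.
These points fill a line, which is disjoint from the cubic iff `k` lies on no chord and no tangent
line, and is otherwise a chord or a tangent line of the cubic; conversely every such line comes from
a vertex.

A camera with center at an isolated real point of the quartic maps the quartic two-to-one onto a
conic, and so does a camera on the cubic with the cubic; here the partner of `P` has its center on
the cubic.  Likewise, two centers on the cubic and on a given secant line can be moved along the
cubic without changing the conics onto which the cubic is mapped.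

The fundamental matrices are compared by means of epipoles: the image of one center under the other
camera is epipolar to every point for one of the configurations, but not for the other.
-/

section

open scoped Matrix LinearAlgebra.Projectivization

/-! ### Real vectors and matrices over the complex numbers -/

section Complexify

variable {ι m n : Type*}

/-- The inclusion `ℝ^ι ⊆ ℂ^ι`: real points as complex points. -/
noncomputable def complexify : (ι → ℝ) →ₗ[ℝ] (ι → ℂ) :=
  Complex.ofRealAm.toLinearMap.compLeft ι

theorem complexify_apply (v : ι → ℝ) (i : ι) : complexify v i = v i := rfl

theorem complexify_injective : Function.Injective (complexify (ι := ι)) :=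
  Complex.ofReal_injective.comp_left

theorem complexify_ne_zero {v : ι → ℝ} : complexify v ≠ 0 ↔ v ≠ 0 :=
  map_ne_zero_iff _ complexify_injective

theorem complexify_mulVec [Fintype n] (M : Matrix m n ℝ) (v : n → ℝ) :
    complexify (M *ᵥ v) = M.map Complex.ofReal *ᵥ complexify v :=
  funext (RingHom.map_mulVec Complex.ofRealHom M v)

theorem star_complexify (v : ι → ℝ) : star (complexify v) = complexify v :=
  funext fun _ => Complex.conj_ofReal _

theorem exists_complexify_eq_of_star_eq {v : ι → ℂ} (h : star v = v) : ∃ w, complexify w = v :=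
  ⟨fun i => (v i).re, funext fun i => Complex.conj_eq_iff_re.1 (congrFun h i)⟩

theorem star_map_ofReal_mulVec [Fintype n] (M : Matrix m n ℝ) (v : n → ℂ) :
    star (M.map Complex.ofReal *ᵥ v) = M.map Complex.ofReal *ᵥ star v := by
  ext i
  simp [Matrix.mulVec, dotProduct]

theorem exists_complexify_mem_notMem {V W : Submodule ℂ (ι → ℂ)} (hV : ∀ v ∈ V, star v ∈ V)
    (hVW : ¬V ≤ W) : ∃ v : ι → ℝ, complexify v ∈ V ∧ complexify v ∉ W := by
  obtain ⟨v, hv, hvW⟩ := SetLike.not_le_iff_exists.1 hVW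
  have hre : complexify (fun i => (v i).re) = (2⁻¹ : ℂ) • (v + star v) := by
    ext i
    simp [complexify_apply, Complex.re_eq_add_conj, div_eq_inv_mul]
  have him : complexify (fun i => (v i).im) = (2 * Complex.I)⁻¹ • (v - star v) := by
    ext i
    simp [complexify_apply, Complex.im_eq_sub_conj, div_eq_inv_mul]
  have hsum : complexify (fun i => (v i).re) + Complex.I • complexify (fun i => (v i).im) = v := by
    ext i
    simp [complexify_apply, mul_comm Complex.I, Complex.re_add_im]
  by_cases h : complexify (fun i => (v i).re) ∈ W
  · refine ⟨_, him ▸ V.smul_mem _ (sub_mem hv (hV v hv)), fun h' => hvW ?_⟩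
    rw [← hsum]
    exact add_mem h (W.smul_mem _ h')
  · exact ⟨_, hre ▸ V.smul_mem _ (add_mem hv (hV v hv)), h⟩

theorem exists_complexify_notMem {W : Submodule ℂ (ι → ℂ)} (hW : W ≠ ⊤) :
    ∃ v : ι → ℝ, complexify v ∉ W := by
  obtain ⟨v, -, hv⟩ := exists_complexify_mem_notMem (V := ⊤) (fun _ _ => Submodule.mem_top)
    (mt top_le_iff.1 hW)
  exact ⟨v, hv⟩

theorem linearMap_eq_of_complexify {V : Type*} [AddCommGroup V] [Module ℂ V]
    {f g : (ι → ℂ) →ₗ[ℂ] V} (h : ∀ v, f (complexify v) = g (complexify v)) : f = g := by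
  rw [← LinearMap.eqLocus_eq_top]
  by_contra hne
  obtain ⟨v, hv⟩ := exists_complexify_notMem hne
  exact hv (h v)

theorem map_ofReal_mulVec_surjective [Finite m] [Fintype n] {M : Matrix m n ℝ}
    (h : Function.Surjective M.mulVec) : Function.Surjective (M.map Complex.ofReal).mulVec := by
  classical
  have := Fintype.ofFinite m
  rw [Matrix.mulVec_surjective_iff_exists_right_inverse] at h ⊢
  obtain ⟨N, hN⟩ := h
  refine ⟨N.map Complex.ofRealHom, ?_⟩
  change M.map Complex.ofRealHom * N.map Complex.ofRealHom = 1
  rw [← Matrix.map_mul, hN, Matrix.map_one _ (map_zero _) (map_one _)]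

end Complexify

section LinearAlgebra

variable {K m n : Type*} [Field K]

theorem rank_eq_card_iff_surjective [Fintype m] [Fintype n] {M : Matrix m n K} :
    M.rank = Fintype.card m ↔ Function.Surjective M.mulVec := by
  rw [Matrix.rank, ← Module.finrank_fintype_fun_eq_card K]
  exact ⟨fun h => LinearMap.range_eq_top.1 (Submodule.eq_top_of_finrank_eq h),
    fun h => by rw [LinearMap.range_eq_top.2 h, finrank_top]⟩

theorem exists_eq_smul_of_finrank_ker_eq_one {V W : Type*} [AddCommGroup V] [Module K V]
    [AddCommGroup W] [Module K W] {f : V →ₗ[K] W} (hf : Module.finrank K f.ker = 1) {k v : V}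
    (hk0 : k ≠ 0) (hk : f k = 0) (hv : f v = 0) : ∃ c : K, v = c • k := by
  obtain ⟨c, hc⟩ := (finrank_eq_one_iff_of_nonzero' (⟨k, hk⟩ : f.ker)
    (by simpa [Subtype.ext_iff] using hk0)).1 hf ⟨v, hv⟩
  exact ⟨c, (congrArg Subtype.val hc).symm⟩

theorem finrank_ker_mulVecLin [Fintype m] [Fintype n] {M : Matrix m n K}
    (hM : Function.Surjective M.mulVec) :
    Module.finrank K M.mulVecLin.ker = Fintype.card n - Fintype.card m := by
  have h := LinearMap.finrank_range_add_finrank_ker M.mulVecLin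
  rw [LinearMap.range_eq_top.2 hM, finrank_top, Module.finrank_fintype_fun_eq_card,
    Module.finrank_fintype_fun_eq_card] at h
  omega

theorem exists_matrix_mulVec_eq {V : Type*} [AddCommGroup V] [Module K V] [Fintype n]
    {f : V →ₗ[K] m → K} {g : V →ₗ[K] n → K}
    (hf : Function.Surjective f) (hg : Function.Surjective g) (h : g.ker ≤ f.ker) :
    ∃ M : Matrix m n K, Function.Surjective M.mulVec ∧ ∀ v, M *ᵥ g v = f v := by
  classical
  obtain ⟨s, hs⟩ := g.exists_rightInverse_of_surjective (LinearMap.range_eq_top.2 hg)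
  have hsg (v : V) : f (s (g v)) = f v := by
    have hker : s (g v) - v ∈ g.ker := by
      rw [LinearMap.mem_ker, map_sub, sub_eq_zero]
      exact LinearMap.congr_fun hs (g v)
    rw [← sub_eq_zero, ← map_sub]
    exact h hker
  have hmul (v : V) : LinearMap.toMatrix' (f ∘ₗ s) *ᵥ g v = f v := by
    rw [LinearMap.toMatrix'_mulVec, LinearMap.comp_apply, hsg]
  refine ⟨_, fun y => ?_, hmul⟩
  obtain ⟨v, rfl⟩ := hf y
  exact ⟨g v, hmul v⟩

end LinearAlgebra

/-! ### Cameras -/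

namespace Camera

theorem mat_mulVec_surjective (P : Camera) : Function.Surjective P.mat.mulVec :=
  rank_eq_card_iff_surjective.1 (by simpa using P.rank_eq)

theorem toLin_complexify (P : Camera) (v : Fin 4 → ℝ) :
    P.toLin (complexify v) = complexify (P.mat *ᵥ v) :=
  (complexify_mulVec P.mat v).symm

theorem star_toLin (P : Camera) (v : Fin 4 → ℂ) : star (P.toLin v) = P.toLin (star v) :=
  star_map_ofReal_mulVec _ _

theorem exists_eq_smul (P : Camera) {k v : Fin 4 → ℂ} (hk0 : k ≠ 0) (hk : P.toLin k = 0)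
    (hv : P.toLin v = 0) : ∃ c : ℂ, v = c • k :=
  exists_eq_smul_of_finrank_ker_eq_one P.finrank_ker hk0 hk hv

theorem exists_real_ker (P : Camera) : ∃ p : Fin 4 → ℝ, p ≠ 0 ∧ P.toLin (complexify p) = 0 := by
  have h : P.mat.mulVecLin.ker ≠ ⊥ := LinearMap.ker_ne_bot_of_finrank_lt (by simp)
  obtain ⟨p, hp, hp0⟩ := Submodule.exists_mem_ne_zero_of_ne_bot h
  rw [LinearMap.mem_ker, Matrix.mulVecLin_apply] at hp
  exact ⟨p, hp0, by rw [toLin_complexify, hp, map_zero]⟩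

theorem center_eq_mk_iff (P : Camera) {v : Fin 4 → ℂ} (hv : v ≠ 0) :
    P.center = Projectivization.mk ℂ v hv ↔ P.toLin v = 0 := by
  obtain ⟨a, ha⟩ := Projectivization.exists_smul_eq_mk_rep ℂ v hv
  rw [eq_comm, ← P.toLin_eq_zero_iff, ← ha, Units.smul_def, map_smul, smul_eq_zero]
  simp

theorem center_eq_iff {P Q : Camera} {v : Fin 4 → ℂ} (hv : v ≠ 0) (hP : P.toLin v = 0) :
    P.center = Q.center ↔ Q.toLin v = 0 := by
  rw [(P.center_eq_mk_iff hv).2 hP, eq_comm, Q.center_eq_mk_iff]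

theorem exists_mulVec_eq {V : Type*} [AddCommGroup V] [Module ℝ V] {f : V →ₗ[ℝ] Fin 3 → ℝ}
    {g : V →ₗ[ℝ] Fin 4 → ℝ} (hf : Function.Surjective f) (hg : Function.Surjective g)
    (h : g.ker ≤ f.ker) : ∃ P : Camera, ∀ v, P.mat *ᵥ g v = f v := by
  obtain ⟨M, hM, hMg⟩ := exists_matrix_mulVec_eq hf hg h
  exact ⟨⟨M, by simpa using rank_eq_card_iff_surjective.2 hM⟩, hMg⟩

theorem sees_mk_iff (P : Camera) {v : Fin 4 → ℂ} (hv : v ≠ 0) (u : P2) :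
    P.Sees (Projectivization.mk ℂ v hv) u ↔ P.toLin v ∈ u.submodule := by
  obtain ⟨a, ha⟩ := Projectivization.exists_smul_eq_mk_rep ℂ v hv
  rw [Sees, ← ha, Units.smul_def, map_smul]
  exact Submodule.smul_mem_iff _ a.ne_zero

end Camera

/-! ### Fundamental forms -/

/-- The matrix `[P x 0; Q 0 y]`, whose determinant is the fundamental form, in block form. -/
def epipolarMatrix (P Q : Camera) (x y : Fin 3 → ℝ) : Matrix (Fin 3 ⊕ Fin 3) (Fin 4 ⊕ Fin 2) ℝ :=
  Matrix.fromBlocks P.mat (.of fun i => ![x i, 0]) Q.mat (.of fun i => ![0, y i])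

theorem fundamentalForm_eq_det (P Q : Camera) (x y : Fin 3 → ℝ) :
    fundamentalForm P Q x y =
      ((epipolarMatrix P Q x y).reindex finSumFinEquiv finSumFinEquiv).det := by
  rw [fundamentalForm]
  congr 1
  ext i j
  fin_cases i <;> fin_cases j <;> rfl

theorem fundamentalForm_eq_det_updateCol_left (P Q : Camera) (x y : Fin 3 → ℝ) :
    fundamentalForm P Q x y = (((epipolarMatrix P Q 0 y).reindex finSumFinEquiv
      finSumFinEquiv).updateCol 4 (Sum.elim x 0 ∘ finSumFinEquiv.symm)).det := by
  rw [fundamentalForm]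
  congr 1
  ext i j
  fin_cases i <;> fin_cases j <;> rfl

theorem fundamentalForm_eq_det_updateCol_right (P Q : Camera) (x y : Fin 3 → ℝ) :
    fundamentalForm P Q x y = (((epipolarMatrix P Q x 0).reindex finSumFinEquiv
      finSumFinEquiv).updateCol 5 (Sum.elim 0 y ∘ finSumFinEquiv.symm)).det := by
  rw [fundamentalForm]
  congr 1
  ext i j
  fin_cases i <;> fin_cases j <;> rfl

/-- The fundamental form as a bilinear form, represented by the fundamental matrix. -/
noncomputable def fundamentalBilin (P Q : Camera) :
    (Fin 3 → ℝ) →ₗ[ℝ] (Fin 3 → ℝ) →ₗ[ℝ] ℝ :=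
  LinearMap.mk₂ ℝ (fundamentalForm P Q)
    (fun x x' y => by
      simp only [fundamentalForm_eq_det_updateCol_left, ← Matrix.det_updateCol_add]
      congr 2
      ext i
      rcases h : finSumFinEquiv.symm i <;> simp [h])
    (fun c x y => by
      simp only [fundamentalForm_eq_det_updateCol_left, smul_eq_mul, ← Matrix.det_updateCol_smul]
      congr 2
      ext i
      rcases h : finSumFinEquiv.symm i <;> simp [h])
    (fun x y y' => by
      simp only [fundamentalForm_eq_det_updateCol_right, ← Matrix.det_updateCol_add]
      congr 2
      ext i
      rcases h : finSumFinEquiv.symm i <;> simp [h])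
    (fun c x y => by
      simp only [fundamentalForm_eq_det_updateCol_right, smul_eq_mul, ← Matrix.det_updateCol_smul]
      congr 2
      ext i
      rcases h : finSumFinEquiv.symm i <;> simp [h])

theorem toMatrix₂'_fundamentalBilin (P Q : Camera) :
    LinearMap.toMatrix₂' ℝ (fundamentalBilin P Q) = fundamentalMatrix P Q := by
  ext i j
  simp only [LinearMap.toMatrix₂'_apply, fundamentalBilin, LinearMap.mk₂_apply, fundamentalMatrix,
    Matrix.of_apply]

theorem fundamentalForm_eq_smul {P₁ P₂ Q₁ Q₂ : Camera} {c : ℝ}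
    (h : fundamentalMatrix Q₁ Q₂ = c • fundamentalMatrix P₁ P₂) (x y : Fin 3 → ℝ) :
    fundamentalForm Q₁ Q₂ x y = c * fundamentalForm P₁ P₂ x y := by
  rw [← toMatrix₂'_fundamentalBilin, ← toMatrix₂'_fundamentalBilin, ← map_smul,
    EmbeddingLike.apply_eq_iff_eq] at h
  exact LinearMap.congr_fun₂ h x y

theorem epipolarMatrix_mulVec_eq_zero_iff (P Q : Camera) (x y : Fin 3 → ℝ) (v : Fin 4 → ℂ)
    (a b : ℂ) :
    (epipolarMatrix P Q x y).map Complex.ofRealHom *ᵥ Sum.elim v ![-a, -b] = 0 ↔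
      P.toLin v = a • complexify x ∧ Q.toLin v = b • complexify y := by
  have hcol (p q : Fin 3 → ℝ) :
      (Matrix.of fun i => ![p i, q i]).map Complex.ofRealHom *ᵥ ![-a, -b] =
        -(a • complexify p + b • complexify q) := by
    ext i
    simp [Matrix.mulVec, dotProduct, complexify_apply]
    ring
  rw [epipolarMatrix, Matrix.fromBlocks_map, Matrix.fromBlocks_mulVec, Sum.elim_comp_inl,
    Sum.elim_comp_inr, ← Sum.elim_zero_zero, Sum.elim_eq_iff]
  have hx := hcol x 0
  have hy := hcol 0 y
  simp only [map_zero, smul_zero, add_zero, zero_add] at hx hy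
  exact and_congr (by rw [← sub_eq_zero (a := P.toLin v), sub_eq_add_neg, ← hx]; rfl)
    (by rw [← sub_eq_zero (a := Q.toLin v), sub_eq_add_neg, ← hy]; rfl)

theorem fundamentalForm_eq_zero_iff (P Q : Camera) (x y : Fin 3 → ℝ) :
    fundamentalForm P Q x y = 0 ↔ ∃ (v : Fin 4 → ℂ) (a b : ℂ), ¬ (v = 0 ∧ a = 0 ∧ b = 0) ∧
      P.toLin v = a • complexify x ∧ Q.toLin v = b • complexify y := by
  rw [← Complex.ofReal_eq_zero, fundamentalForm_eq_det, ← Complex.ofRealHom_eq_coe,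
    RingHom.map_det, ← Matrix.exists_mulVec_eq_zero_iff]
  let e : Fin 4 ⊕ Fin 2 ≃ Fin 6 := finSumFinEquiv
  have hmul (t : Fin 6 → ℂ) :
      Complex.ofRealHom.mapMatrix
        ((epipolarMatrix P Q x y).reindex finSumFinEquiv finSumFinEquiv) *ᵥ t = 0 ↔
      (epipolarMatrix P Q x y).map Complex.ofRealHom *ᵥ (t ∘ e) = 0 := by
    rw [RingHom.mapMatrix_apply, Matrix.reindex_apply, ← Matrix.submatrix_map,
      Matrix.submatrix_mulVec_equiv, Equiv.symm_symm]
    exact ⟨fun h => finSumFinEquiv.symm.surjective.injective_comp_right h, fun h => by rw [h]; rfl⟩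
  simp only [hmul, ← epipolarMatrix_mulVec_eq_zero_iff]
  constructor
  · rintro ⟨t, ht, h⟩
    have hs : t ∘ e = Sum.elim (t ∘ e ∘ Sum.inl) ![- -t 4, - -t 5] := by
      ext (i | i)
      · rfl
      · fin_cases i <;> simp <;> rfl
    refine ⟨_, -t 4, -t 5, fun h0 => ht ?_, hs ▸ h⟩
    rw [h0.1, h0.2.1, h0.2.2] at hs
    refine e.surjective.injective_comp_right (hs.trans ?_)
    ext (i | i)
    · rfl
    · fin_cases i <;> simp
  · rintro ⟨v, a, b, h0, h⟩
    refine ⟨Sum.elim v ![-a, -b] ∘ e.symm, fun ht => h0 ?_, ?_⟩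
    · have hs (i) : Sum.elim v ![-a, -b] i = 0 := by
        simpa using congrFun ht (e i)
      exact ⟨funext fun i => hs (.inl i), by simpa using hs (.inr 0), by simpa using hs (.inr 1)⟩
    · rwa [Function.comp_assoc, Equiv.symm_comp_self]

theorem fundamentalForm_eq_zero_comm (P Q : Camera) (x y : Fin 3 → ℝ) :
    fundamentalForm P Q x y = 0 ↔ fundamentalForm Q P y x = 0 := by
  rw [fundamentalForm_eq_zero_iff, fundamentalForm_eq_zero_iff]
  constructor <;>
  · rintro ⟨v, a, b, h0, h1, h2⟩
    exact ⟨v, b, a, fun h => h0 ⟨h.1, h.2.2, h.2.1⟩, h2, h1⟩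

/-- Some pair of image points is epipolar for exactly one of the two pairs of cameras.  Unlike
the fundamental matrix, this notion survives scaling and projective transformations, so it rules out
equivalence of configurations as well. -/
def Distinguishable (P₁ P₂ Q₁ Q₂ : Camera) : Prop :=
  ∃ x y, ¬ (fundamentalForm P₁ P₂ x y = 0 ↔ fundamentalForm Q₁ Q₂ x y = 0)

namespace Distinguishable

variable {P₁ P₂ Q₁ Q₂ : Camera}

theorem symm (h : Distinguishable P₁ P₂ Q₁ Q₂) : Distinguishable Q₁ Q₂ P₁ P₂ := by
  obtain ⟨x, y, h⟩ := h
  exact ⟨x, y, fun h' => h h'.symm⟩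

theorem swap (h : Distinguishable P₁ P₂ Q₁ Q₂) : Distinguishable P₂ P₁ Q₂ Q₁ := by
  obtain ⟨x, y, h⟩ := h
  refine ⟨y, x, fun h' => h ?_⟩
  rw [fundamentalForm_eq_zero_comm, h', fundamentalForm_eq_zero_comm]

theorem fundamentalMatrix_ne (h : Distinguishable P₁ P₂ Q₁ Q₂) :
    ¬ ∃ c : ℝ, c ≠ 0 ∧ fundamentalMatrix Q₁ Q₂ = c • fundamentalMatrix P₁ P₂ := by
  rintro ⟨c, hc, hF⟩
  obtain ⟨x, y, h⟩ := h
  exact h (by simp [fundamentalForm_eq_smul hF, hc])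

theorem not_equivalent {n : ℕ} {P Q : CameraTuple n} {i j : Fin n}
    (h : Distinguishable (P.cam i) (P.cam j) (Q.cam i) (Q.cam j)) (X Y : Set P3) :
    ¬ Equivalent P X Q Y := by
  rintro ⟨H, -, hH⟩
  obtain ⟨x, y, h⟩ := h
  obtain ⟨c, hc, hci⟩ := hH i
  obtain ⟨d, hd, hdj⟩ := hH j
  apply h
  rw [fundamentalForm_eq_zero_iff, fundamentalForm_eq_zero_iff]
  constructor
  · rintro ⟨v, a, b, h0, h1, h2⟩
    refine ⟨H v, c⁻¹ * a, d⁻¹ * b, by simpa [hc, hd] using h0, ?_, ?_⟩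
    · rw [mul_smul, ← h1, hci, inv_smul_smul₀ hc]
    · rw [mul_smul, ← h2, hdj, inv_smul_smul₀ hd]
  · rintro ⟨v, a, b, h0, h1, h2⟩
    refine ⟨H.symm v, c * a, d * b, by simpa [hc, hd] using h0, ?_, ?_⟩
    · rw [hci, H.apply_symm_apply, h1, smul_smul]
    · rw [hdj, H.apply_symm_apply, h2, smul_smul]

end Distinguishable

theorem exists_complexify_notMem_map_toLin (P Q : Camera) (u : Fin 4 → ℂ) :
    ∃ x : Fin 3 → ℝ, complexify x ∉ (Submodule.span ℂ {u} ⊔ Q.toLin.ker).map P.toLin := by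
  refine exists_complexify_notMem fun htop => ?_
  have hle := (Submodule.finrank_map_le P.toLin (Submodule.span ℂ {u} ⊔ Q.toLin.ker)).trans
    (Submodule.finrank_add_le_finrank_add_finrank _ _)
  have hu := finrank_span_le_card (R := ℂ) {u}
  rw [htop, finrank_top, Module.finrank_fin_fun, Q.finrank_ker] at hle
  simp only [Set.toFinset_singleton, Finset.card_singleton] at hu
  omega

/-- The image `y` under `P₂` of the center of `P₁` is epipolar to every `x` for `(P₁, P₂)`.  For
`(Q₁, Q₂)` it is epipolar only to the image of the plane spanned by `u` and the base line. -/
theorem distinguishable_of_epipole {P₁ P₂ Q₁ Q₂ : Camera} {c u : Fin 4 → ℂ} (hc0 : c ≠ 0)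
    (hc : P₁.toLin c = 0) (hcu : P₂.toLin c = Q₂.toLin u) (hQ : Q₁.center ≠ Q₂.center)
    (hu : u ∉ Q₁.toLin.ker ⊔ Q₂.toLin.ker) : Distinguishable P₁ P₂ Q₁ Q₂ := by
  obtain ⟨p, hp0, hp⟩ := P₁.exists_real_ker
  obtain ⟨r, hr⟩ := P₁.exists_eq_smul hc0 hc hp
  obtain ⟨x, hx⟩ := exists_complexify_notMem_map_toLin Q₁ Q₂ u
  have hy : complexify (P₂.mat *ᵥ p) = r • Q₂.toLin u := by
    rw [← Camera.toLin_complexify, hr, map_smul, hcu]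
  have hr0 : r ≠ 0 := fun h => complexify_ne_zero.2 hp0 (by rw [hr, h, zero_smul])
  refine ⟨x, P₂.mat *ᵥ p, fun hiff => ?_⟩
  have hP : fundamentalForm P₁ P₂ x (P₂.mat *ᵥ p) = 0 :=
    (fundamentalForm_eq_zero_iff ..).2 ⟨complexify p, 0, 1, by simp, by simpa using hp,
      by rw [one_smul, Camera.toLin_complexify]⟩
  obtain ⟨v, a, b, h0, hv₁, hv₂⟩ := (fundamentalForm_eq_zero_iff ..).1 (hiff.1 hP)
  have hker : v - (b * r) • u ∈ Q₂.toLin.ker := by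
    rw [LinearMap.mem_ker, map_sub, map_smul, hv₂, hy, smul_smul, sub_self]
  have ha : a = 0 := by
    by_contra ha
    refine hx ((Submodule.smul_mem_iff _ ha).1 (hv₁ ▸ Submodule.mem_map_of_mem ?_))
    rw [← add_sub_cancel ((b * r) • u) v]
    exact Submodule.add_mem_sup (Submodule.smul_mem _ _ (Submodule.mem_span_singleton_self u)) hker
  have hv : Q₁.toLin v = 0 := by rw [hv₁, ha, zero_smul]
  have hb : b = 0 := by
    by_contra hb
    refine hu ((Submodule.smul_mem_iff _ (mul_ne_zero hb hr0)).1 ?_)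
    rw [← sub_sub_cancel v ((b * r) • u)]
    exact sub_mem (Submodule.mem_sup_left hv) (Submodule.mem_sup_right hker)
  refine h0 ⟨by_contra fun hv0 => hQ ((Camera.center_eq_iff hv0 hv).2 ?_), ha, hb⟩
  rw [hv₂, hb, zero_smul]

/-! ### Conjugate configurations from common images -/

/-- Some image point is an image of `x` under `P` and of `y` under `Q`. -/
def HaveCommonImage (P Q : Camera) (x y : P3) : Prop :=
  ∃ u, P.Sees x u ∧ Q.Sees y u

theorem HaveCommonImage.symm {P Q : Camera} {x y : P3} (h : HaveCommonImage P Q x y) :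
    HaveCommonImage Q P y x := by
  obtain ⟨u, hx, hy⟩ := h
  exact ⟨u, hy, hx⟩

theorem haveCommonImage_mk {P Q : Camera} {v w : Fin 4 → ℂ} (hv : v ≠ 0) (hw : w ≠ 0)
    {m : Fin 3 → ℂ} {a b : ℂ} (hP : P.toLin v = a • m) (hQ : Q.toLin w = b • m) :
    HaveCommonImage P Q (Projectivization.mk ℂ v hv) (Projectivization.mk ℂ w hw) := by
  obtain ⟨u, hu⟩ : ∃ u : P2, m ∈ u.submodule := by
    by_cases hm : m = 0
    · exact ⟨Projectivization.mk ℂ (Pi.single 0 1) (by simp), by simp [hm]⟩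
    · exact ⟨Projectivization.mk ℂ m hm, by simp⟩
  refine ⟨u, ?_, ?_⟩
  · rw [Camera.sees_mk_iff, hP]
    exact Submodule.smul_mem _ _ hu
  · rw [Camera.sees_mk_iff, hQ]
    exact Submodule.smul_mem _ _ hu

section CommonImages

variable {n : ℕ} {ι : Type*} {P Q : CameraTuple n} {f g : ι → P3}

theorem isReconstruction_image (h : ∀ i z, HaveCommonImage (P.cam i) (Q.cam i) (f z) (g z))
    (Z : Set ι) : IsReconstruction P (f '' Z)
      {s | ∃ z ∈ Z, ∀ i, (P.cam i).Sees (f z) (s i) ∧ (Q.cam i).Sees (g z) (s i)} := by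
  choose u hP hQ using h
  refine ⟨?_, ?_⟩
  · rintro s ⟨z, hz, hs⟩
    exact ⟨_, ⟨z, hz, rfl⟩, fun i => (hs i).1⟩
  · rintro _ ⟨z, hz, rfl⟩
    exact ⟨fun i => u i z, ⟨z, hz, fun i => ⟨hP i z, hQ i z⟩⟩, fun i => hP i z⟩

theorem conjugate_image (h : ∀ i z, HaveCommonImage (P.cam i) (Q.cam i) (f z) (g z)) {i j : Fin n}
    (hD : Distinguishable (P.cam i) (P.cam j) (Q.cam i) (Q.cam j)) (Z : Set ι) :
    Conjugate P (f '' Z) Q (g '' Z) := by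
  refine ⟨⟨_, isReconstruction_image h Z, ?_⟩, hD.not_equivalent _ _⟩
  convert isReconstruction_image (fun i z => (h i z).symm) Z using 7
  exact and_comm

theorem conjugateAlong_range (hn : 2 ≤ n)
    (h : ∀ i z, HaveCommonImage (P.cam i) (Q.cam i) (f z) (g z))
    (hD : ∀ i j, i ≠ j → Distinguishable (P.cam i) (P.cam j) (Q.cam i) (Q.cam j)) :
    ConjugateAlong P (Set.range f) Q (Set.range g) := by
  have hconj (Z : Set ι) : NonTriviallyConjugate P (f '' Z) Q (g '' Z) :=
    ⟨conjugate_image h (hD ⟨0, by omega⟩ ⟨1, by omega⟩ (by simp)) Z,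
      fun i j hij => (hD i j hij).fundamentalMatrix_ne⟩
  refine ⟨by simpa only [Set.image_univ] using hconj Set.univ, fun X hX => ?_, fun Y hY => ?_⟩
  · exact ⟨_, Set.image_subset_range g _, Set.image_preimage_eq_of_subset hX ▸ hconj (f ⁻¹' X)⟩
  · exact ⟨_, Set.image_subset_range f _, Set.image_preimage_eq_of_subset hY ▸ hconj (g ⁻¹' Y)⟩

end CommonImages

theorem ConjugateAlong.isNonTriviallyCritical {n : ℕ} {P Q : CameraTuple n} {C D : Set P3}
    (h : ConjugateAlong P C Q D) {X : Set P3} (hX : X ⊆ C) : IsNonTriviallyCritical P X := by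
  obtain ⟨Y, -, hY⟩ := h.2.1 X hX
  exact ⟨Q, Y, hY⟩

section BinaryForms

variable {K : Type*} [Field K] {d : ℕ}

/-- The point with parameter `z` of the rational normal curve of degree `d`; over `ℂ` this is
`veronese d z`. -/
def veroneseVec (d : ℕ) (z : Fin 2 → K) : Fin (d + 1) → K :=
  fun k => z 0 ^ (k : ℕ) * z 1 ^ (d - (k : ℕ))

/-- The bracket of two points of the projective line, which vanishes iff they coincide. -/
def bracket : (Fin 2 → K) →ₗ[K] (Fin 2 → K) →ₗ[K] K :=
  LinearMap.mk₂ K (fun w z => w 1 * z 0 - w 0 * z 1)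
    (fun _ _ _ => by simp only [Pi.add_apply]; ring)
    (fun _ _ _ => by simp only [Pi.smul_apply, smul_eq_mul]; ring)
    (fun _ _ _ => by simp only [Pi.add_apply]; ring)
    (fun _ _ _ => by simp only [Pi.smul_apply, smul_eq_mul]; ring)

/-- Contraction of a dual binary form of degree `d + 1` with the linear form vanishing at `w`:
the projection of the rational normal curve of degree `d + 1` from its point `w` onto the one of
degree `d`. -/
def contract : (Fin 2 → K) →ₗ[K] (Fin (d + 2) → K) →ₗ[K] (Fin (d + 1) → K) :=
  LinearMap.mk₂ K (fun w v i => w 1 * v i.succ - w 0 * v i.castSucc)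
    (fun _ _ _ => by ext; simp only [Pi.add_apply]; ring)
    (fun _ _ _ => by ext; simp only [Pi.smul_apply, smul_eq_mul]; ring)
    (fun _ _ _ => by ext; simp only [Pi.add_apply]; ring)
    (fun _ _ _ => by ext; simp only [Pi.smul_apply, smul_eq_mul]; ring)

theorem bracket_apply (w z : Fin 2 → K) : bracket w z = w 1 * z 0 - w 0 * z 1 := rfl

theorem contract_apply (w : Fin 2 → K) (v : Fin (d + 2) → K) (i : Fin (d + 1)) :
    contract w v i = w 1 * v i.succ - w 0 * v i.castSucc := rfl

@[simp]
theorem bracket_self (z : Fin 2 → K) : bracket z z = 0 := by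
  rw [bracket_apply]; ring

theorem bracket_swap (w z : Fin 2 → K) : bracket w z = -bracket z w := by
  simp only [bracket_apply]; ring

theorem bracket_ne_zero_comm {w z : Fin 2 → K} : bracket w z ≠ 0 ↔ bracket z w ≠ 0 := by
  rw [bracket_swap, neg_ne_zero]

theorem left_ne_zero_of_bracket_ne_zero {w z : Fin 2 → K} (h : bracket w z ≠ 0) : w ≠ 0 := by
  rintro rfl
  simp at h

theorem right_ne_zero_of_bracket_ne_zero {w z : Fin 2 → K} (h : bracket w z ≠ 0) : z ≠ 0 := by
  rintro rfl
  simp at h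

theorem exists_eq_smul_of_bracket_eq_zero {w z : Fin 2 → K} (hz : z ≠ 0)
    (h : bracket w z = 0) : ∃ c : K, w = c • z := by
  rw [bracket_apply, sub_eq_zero] at h
  by_cases h0 : z 0 = 0
  · have h1 : z 1 ≠ 0 := fun h1 => hz (by ext i; fin_cases i <;> assumption)
    refine ⟨w 1 / z 1, funext (Fin.forall_fin_two.2 ⟨?_, ?_⟩)⟩
    · simpa [h0, h1] using h.symm
    · simp [h1]
  · refine ⟨w 0 / z 0, funext (Fin.forall_fin_two.2 ⟨?_, ?_⟩)⟩
    · simp [h0]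
    · simp only [Pi.smul_apply, smul_eq_mul]
      field_simp
      exact h

theorem exists_bracket_ne_zero {z : Fin 2 → K} (hz : z ≠ 0) : ∃ w, bracket z w ≠ 0 := by
  by_contra! h
  have h0 := h ![1, 0]
  have h1 := h ![0, 1]
  simp only [bracket_apply, Matrix.cons_val_zero, Matrix.cons_val_one, mul_one, mul_zero, sub_zero,
    zero_sub, neg_eq_zero] at h0 h1
  exact hz (funext (Fin.forall_fin_two.2 ⟨h1, h0⟩))

theorem veroneseVec_smul (c : K) (z : Fin 2 → K) :
    veroneseVec d (c • z) = c ^ d • veroneseVec d z := by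
  ext k
  have hk : c ^ d = c ^ (k : ℕ) * c ^ (d - (k : ℕ)) := by
    rw [← pow_add, Nat.add_sub_cancel' (Nat.le_of_lt_succ k.isLt)]
  simp only [veroneseVec, Pi.smul_apply, smul_eq_mul, hk]
  ring

theorem veroneseVec_ne_zero {z : Fin 2 → K} (hz : z ≠ 0) : veroneseVec d z ≠ 0 := by
  contrapose! hz
  have h0 := congrFun hz 0
  have h1 := congrFun hz (Fin.last d)
  simp only [veroneseVec, Fin.val_zero, Fin.val_last, pow_zero, tsub_zero, tsub_self, one_mul,
    mul_one, Pi.zero_apply] at h0 h1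
  exact funext (Fin.forall_fin_two.2 ⟨eq_zero_of_pow_eq_zero h1, eq_zero_of_pow_eq_zero h0⟩)

theorem contract_comm (w z : Fin 2 → K) (v : Fin (d + 3) → K) :
    contract w (contract z v) = contract z (contract w v) := by
  ext i
  simp only [contract_apply, Fin.succ_castSucc]
  ring

theorem contract_veroneseVec (w z : Fin 2 → K) :
    contract w (veroneseVec (d + 1) z) = bracket w z • veroneseVec d z := by
  ext i
  have hi : d + 1 - (i : ℕ) = d - i + 1 := Nat.sub_add_comm (Nat.le_of_lt_succ i.isLt)
  simp only [contract_apply, veroneseVec, bracket_apply, Fin.val_succ, Fin.val_castSucc,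
    Nat.add_sub_add_right, hi, Pi.smul_apply, smul_eq_mul]
  ring

theorem exists_eq_smul_veroneseVec {w : Fin 2 → K} (hw : w ≠ 0) {v : Fin (d + 2) → K}
    (h : contract w v = 0) : ∃ a : K, v = a • veroneseVec (d + 1) w := by
  have hstep (i : Fin (d + 1)) : w 1 * v i.succ = w 0 * v i.castSucc :=
    sub_eq_zero.1 (congrFun h i)
  by_cases h1 : w 1 = 0
  · have h0 : w 0 ≠ 0 := fun h0 => hw (funext (Fin.forall_fin_two.2 ⟨h0, h1⟩))
    have hv (i : Fin (d + 1)) : v i.castSucc = 0 := by simpa [h1, h0] using (hstep i).symm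
    refine ⟨v (Fin.last _) / w 0 ^ (d + 1), funext (Fin.lastCases ?_ fun j => ?_)⟩
    · simp [veroneseVec, h0]
    · have : d + 1 - (j : ℕ) ≠ 0 := by omega
      simp [hv, veroneseVec, h1, this]
  · refine ⟨v 0 / w 1 ^ (d + 1), funext fun i => ?_⟩
    induction i using Fin.induction with
    | zero => simp [veroneseVec, h1]
    | succ j ih =>
      apply mul_left_cancel₀ h1
      have hj : d + 1 - (j : ℕ) = d - j + 1 := by omega
      simp only [hstep, ih, veroneseVec, Pi.smul_apply, smul_eq_mul, Fin.val_succ,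
        Fin.val_castSucc, hj, Nat.add_sub_add_right]
      ring

theorem ker_contract {w : Fin 2 → K} (hw : w ≠ 0) :
    LinearMap.ker (contract (d := d) w) = K ∙ veroneseVec (d + 1) w := by
  ext v
  rw [LinearMap.mem_ker, Submodule.mem_span_singleton]
  refine ⟨fun h => ?_, ?_⟩
  · obtain ⟨a, ha⟩ := exists_eq_smul_veroneseVec hw h
    exact ⟨a, ha.symm⟩
  · rintro ⟨a, rfl⟩
    rw [map_smul, contract_veroneseVec, bracket_self, zero_smul, smul_zero]

theorem contract_surjective {w : Fin 2 → K} (hw : w ≠ 0) :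
    Function.Surjective (contract (d := d) w) := by
  rw [← LinearMap.range_eq_top]
  apply Submodule.eq_top_of_finrank_eq
  have h := LinearMap.finrank_range_add_finrank_ker (contract (d := d) w)
  rw [ker_contract hw, finrank_span_singleton (veroneseVec_ne_zero hw)] at h
  simp only [Module.finrank_fin_fun] at h ⊢
  omega

theorem eq_zero_of_smul_veroneseVec_add {z w : Fin 2 → K} (h : bracket z w ≠ 0) {a b : K}
    (hab : a • veroneseVec (d + 1) z + b • veroneseVec (d + 1) w = 0) : a = 0 ∧ b = 0 := by
  have hz := congrArg (contract z) hab
  have hw := congrArg (contract w) hab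
  simpa [contract_veroneseVec, h, bracket_ne_zero_comm.1 h,
    veroneseVec_ne_zero (left_ne_zero_of_bracket_ne_zero h),
    veroneseVec_ne_zero (right_ne_zero_of_bracket_ne_zero h)] using And.intro hw hz

theorem eq_zero_of_smul_veroneseVec_add_add {x y z : Fin 2 → K} (hxy : bracket x y ≠ 0)
    (hxz : bracket x z ≠ 0) (hyz : bracket y z ≠ 0) {a b c : K}
    (h : a • veroneseVec (d + 2) x + b • veroneseVec (d + 2) y + c • veroneseVec (d + 2) z = 0) :
    a = 0 ∧ b = 0 ∧ c = 0 := by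
  have hx := congrArg (contract x) h
  simp only [map_add, map_smul, map_zero, contract_veroneseVec, bracket_self, zero_smul,
    smul_zero, zero_add, smul_smul] at hx
  obtain ⟨hb, hc⟩ := eq_zero_of_smul_veroneseVec_add hyz hx
  obtain rfl : b = 0 := by simpa [hxy] using hb
  obtain rfl : c = 0 := by simpa [hxz] using hc
  simpa [veroneseVec_ne_zero (left_ne_zero_of_bracket_ne_zero hxy)] using h

theorem exists_eq_veroneseVec_add {z w : Fin 2 → K} (h : bracket w z ≠ 0) {a : K}
    {k : Fin (d + 2) → K} (hk : contract w k = a • veroneseVec d z) :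
    ∃ α β : K, k = α • veroneseVec (d + 1) z + β • veroneseVec (d + 1) w := by
  have hker : contract w (k - (a / bracket w z) • veroneseVec (d + 1) z) = 0 := by
    rw [map_sub, map_smul, contract_veroneseVec, hk, smul_smul, div_mul_cancel₀ _ h, sub_self]
  obtain ⟨β, hβ⟩ := exists_eq_smul_veroneseVec (left_ne_zero_of_bracket_ne_zero h) hker
  exact ⟨_, β, by rw [← hβ, add_sub_cancel]⟩

theorem exists_eq_veroneseVec_add_of_contract_contract {z w : Fin 2 → K} (h : bracket z w ≠ 0)
    {k : Fin (d + 3) → K} (hk : contract z (contract w k) = 0) :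
    ∃ α β : K, k = α • veroneseVec (d + 2) z + β • veroneseVec (d + 2) w := by
  obtain ⟨a, ha⟩ := exists_eq_smul_veroneseVec (left_ne_zero_of_bracket_ne_zero h) hk
  exact exists_eq_veroneseVec_add (bracket_ne_zero_comm.1 h) ha

theorem linearIndependent_of_bracket_ne_zero {z w : Fin 2 → K}
    (hzw : bracket z w ≠ 0) : LinearIndependent K ![z, w] := by
  rw [LinearIndependent.pair_iff]
  intro s t hst
  have hz := congrArg (bracket z) hst
  have hw := congrArg (bracket w) hst
  simpa [hzw, bracket_ne_zero_comm.1 hzw] using And.intro hw hz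

end BinaryForms

section Derivative

variable {d : ℕ}

theorem differentiableAt_veroneseVec (z : Fin 2 → ℂ) :
    DifferentiableAt ℂ (veroneseVec d) z := by
  unfold veroneseVec
  fun_prop

theorem contract_fderiv_veroneseVec (w z h : Fin 2 → ℂ) :
    contract w (fderiv ℂ (veroneseVec (d + 1)) z h) =
      bracket w h • veroneseVec d z + bracket w z • fderiv ℂ (veroneseVec d) z h := by
  have hl := (contract (d := d) w).toContinuousLinearMap.hasFDerivAt.comp z
    (differentiableAt_veroneseVec z).hasFDerivAt
  have hr := (bracket w).toContinuousLinearMap.hasFDerivAt.smul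
    (differentiableAt_veroneseVec (d := d) z).hasFDerivAt
  have heq : (contract (d := d) w).toContinuousLinearMap ∘ veroneseVec (d + 1) =
      fun z => (bracket w).toContinuousLinearMap z • veroneseVec d z :=
    funext fun z => contract_veroneseVec w z
  rw [heq] at hl
  exact (DFunLike.congr_fun (hl.unique hr) h).trans (add_comm _ _)

theorem fderiv_veroneseVec_self (z : Fin 2 → ℂ) :
    fderiv ℂ (veroneseVec d) z z = (d : ℂ) • veroneseVec d z := by
  have hline : HasDerivAt (fun c : ℂ => c • z) z 1 := by
    simpa using (hasDerivAt_id (1 : ℂ)).smul_const z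
  have hl := HasFDerivAt.comp_hasDerivAt (1 : ℂ) (f := fun c : ℂ => c • z)
    (differentiableAt_veroneseVec (d := d) ((1 : ℂ) • z)).hasFDerivAt hline
  have hr := (hasDerivAt_pow d (1 : ℂ)).smul_const (veroneseVec d z)
  have heq : veroneseVec d ∘ (fun c : ℂ => c • z) = fun c => c ^ d • veroneseVec d z :=
    funext fun c => veroneseVec_smul c z
  rw [heq] at hl
  simpa using hl.unique hr

theorem exists_eq_fderiv_veroneseVec {k : Fin (d + 3) → ℂ} {z : Fin 2 → ℂ} (hz : z ≠ 0)
    (hk : contract z (contract z k) = 0) : ∃ g, k = fderiv ℂ (veroneseVec (d + 2)) z g := by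
  obtain ⟨a, ha⟩ := exists_eq_smul_veroneseVec hz hk
  obtain ⟨g, hg⟩ := exists_bracket_ne_zero hz
  have hker : contract z (k - (a / bracket z g) • fderiv ℂ (veroneseVec (d + 2)) z g) = 0 := by
    rw [map_sub, map_smul, contract_fderiv_veroneseVec, bracket_self, zero_smul, add_zero, ha,
      smul_smul, div_mul_cancel₀ _ hg, sub_self]
  obtain ⟨b, hb⟩ := exists_eq_smul_veroneseVec hz hker
  have hd : ((d + 2 : ℕ) : ℂ) ≠ 0 := Nat.cast_ne_zero.2 (by omega)
  refine ⟨(a / bracket z g) • g + (b / (d + 2 : ℕ)) • z, ?_⟩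
  rw [map_add, map_smul, map_smul, fderiv_veroneseVec_self, smul_smul, div_mul_cancel₀ _ hd, ← hb,
    add_sub_cancel]

theorem eq_zero_of_fderiv_veroneseVec_eq_zero {z g : Fin 2 → ℂ} (hz : z ≠ 0)
    (hg : fderiv ℂ (veroneseVec (d + 1)) z g = 0) : g = 0 := by
  have hbr := congrArg (contract z) hg
  rw [contract_fderiv_veroneseVec, bracket_self, zero_smul, add_zero, map_zero, smul_eq_zero,
    or_iff_left (veroneseVec_ne_zero hz), bracket_swap, neg_eq_zero] at hbr
  obtain ⟨c, rfl⟩ := exists_eq_smul_of_bracket_eq_zero hz hbr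
  rw [map_smul, fderiv_veroneseVec_self, smul_smul, smul_eq_zero,
    or_iff_left (veroneseVec_ne_zero hz), mul_eq_zero,
    or_iff_left (Nat.cast_ne_zero.2 d.succ_ne_zero)] at hg
  rw [hg, zero_smul]

end Derivative

section Curves

variable {d : ℕ}

/-- The linear map on dual binary forms whose restriction to the rational normal curve is
`paramMap A`. -/
def coeffLin (A : Matrix (Fin 4) (Fin (d + 1)) ℝ) : (Fin (d + 1) → ℂ) →ₗ[ℂ] (Fin 4 → ℂ) :=
  (A.map Complex.ofReal).mulVecLin

theorem coeffLin_veroneseVec (A : Matrix (Fin 4) (Fin (d + 1)) ℝ) (z : Fin 2 → ℂ) :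
    coeffLin A (veroneseVec d z) = paramMap A z := rfl

theorem coeffLin_complexify (A : Matrix (Fin 4) (Fin (d + 1)) ℝ) (v : Fin (d + 1) → ℝ) :
    coeffLin A (complexify v) = complexify (A *ᵥ v) :=
  (complexify_mulVec A v).symm

theorem fderiv_paramMap (A : Matrix (Fin 4) (Fin (d + 1)) ℝ) (z h : Fin 2 → ℂ) :
    fderiv ℂ (paramMap A) z h = coeffLin A (fderiv ℂ (veroneseVec d) z h) := by
  have hA := (coeffLin A).toContinuousLinearMap.hasFDerivAt.comp z
    (differentiableAt_veroneseVec z).hasFDerivAt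
  exact DFunLike.congr_fun hA.fderiv h

theorem paramMap_smul (A : Matrix (Fin 4) (Fin (d + 1)) ℝ) (c : ℂ) (z : Fin 2 → ℂ) :
    paramMap A (c • z) = c ^ d • paramMap A z := by
  rw [← coeffLin_veroneseVec, veroneseVec_smul, map_smul, coeffLin_veroneseVec]

theorem mk_mem_linePoints {L : Submodule ℂ (Fin 4 → ℂ)} {v : Fin 4 → ℂ} (hv : v ≠ 0) :
    Projectivization.mk ℂ v hv ∈ linePoints L ↔ v ∈ L := by
  rw [linePoints, Set.mem_ofPred_eq, Projectivization.submodule_mk,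
    Submodule.span_singleton_le_iff_mem]

theorem Camera.center_mem_linePoints_iff {Q : Camera} {L : Submodule ℂ (Fin 4 → ℂ)} :
    Q.center ∈ linePoints L ↔ Q.toLin.ker ≤ L := by
  obtain ⟨v, hv, hQv⟩ := Q.exists_ker
  rw [(Q.center_eq_mk_iff hv).2 hQv, mk_mem_linePoints]
  refine ⟨fun hvL u hu => ?_, fun h => h hQv⟩
  obtain ⟨c, rfl⟩ := Q.exists_eq_smul hv hQv hu
  exact L.smul_mem c hvL

theorem curve_eq_range {A : Matrix (Fin 4) (Fin (d + 1)) ℝ}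
    (hA : ∀ z : Fin 2 → ℂ, z ≠ 0 → paramMap A z ≠ 0) :
    curve A = Set.range fun z : {z : Fin 2 → ℂ // z ≠ 0} =>
      Projectivization.mk ℂ (paramMap A z) (hA z z.2) := by
  ext x
  constructor
  · rintro ⟨z, hz, h, rfl⟩
    exact ⟨⟨z, hz⟩, rfl⟩
  · rintro ⟨⟨z, hz⟩, rfl⟩
    exact ⟨z, hz, hA z hz, rfl⟩

/-- The point `k` is not on the rational normal curve (and not zero), expressed by contractions. -/
def OffNormalCurve (k : Fin (d + 2) → ℂ) : Prop :=
  ∀ x, contract x k = 0 → x = 0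

/-- The point `k` lies on a chord or a tangent line of the rational normal curve, expressed by
contractions; `z` and `w` are the parameters of the end points of the chord. -/
def OnSecantVariety (k : Fin (d + 3) → ℂ) : Prop :=
  ∃ z w : Fin 2 → ℂ, z ≠ 0 ∧ w ≠ 0 ∧ contract z (contract w k) = 0

theorem OffNormalCurve.exists_contract_eq {k : Fin (d + 3) → ℂ} (hk : OffNormalCurve k)
    {z w : Fin 2 → ℂ} (hz : z ≠ 0) (hw : w ≠ 0) (h : contract z (contract w k) = 0) :
    ∃ a : ℂ, a ≠ 0 ∧ contract w k = a • veroneseVec (d + 1) z := by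
  obtain ⟨a, ha⟩ := exists_eq_smul_veroneseVec hz h
  refine ⟨a, ?_, ha⟩
  rintro rfl
  exact hw (hk w (by rw [ha, zero_smul]))

theorem OffNormalCurve.exists_eq_veroneseVec_add {k : Fin (d + 3) → ℂ} (hk : OffNormalCurve k)
    {z w : Fin 2 → ℂ} (hzw : bracket z w ≠ 0) (h : contract z (contract w k) = 0) :
    ∃ α β : ℂ, α ≠ 0 ∧ β ≠ 0 ∧ k = α • veroneseVec (d + 2) z + β • veroneseVec (d + 2) w := by
  obtain ⟨α, β, rfl⟩ := exists_eq_veroneseVec_add_of_contract_contract hzw h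
  refine ⟨α, β, ?_, ?_, rfl⟩
  · rintro rfl
    refine right_ne_zero_of_bracket_ne_zero hzw (hk w ?_)
    rw [zero_smul, zero_add, map_smul, contract_veroneseVec, bracket_self, zero_smul, smul_zero]
  · rintro rfl
    refine left_ne_zero_of_bracket_ne_zero hzw (hk z ?_)
    rw [zero_smul, add_zero, map_smul, contract_veroneseVec, bracket_self, zero_smul, smul_zero]

/-- The quartic with coefficients `A` is the projection of the rational normal quartic from `k`:
the vector `k` spans the kernel of `A`. -/
structure IsProjectionFrom (A : Matrix (Fin 4) (Fin (4 + 1)) ℝ) (k : Fin (4 + 1) → ℝ) : Prop where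
  rank_eq : A.rank = 4
  ne_zero : k ≠ 0
  mulVec_eq_zero : A *ᵥ k = 0

theorem exists_isProjectionFrom_of_rank_eq {A : Matrix (Fin 4) (Fin (4 + 1)) ℝ} (hA : A.rank = 4) :
    ∃ k, IsProjectionFrom A k := by
  have hker : A.mulVecLin.ker ≠ ⊥ := LinearMap.ker_ne_bot_of_finrank_lt (by simp)
  obtain ⟨k, hk, hk0⟩ := Submodule.exists_mem_ne_zero_of_ne_bot hker
  exact ⟨k, hA, hk0, hk⟩

namespace IsProjectionFrom

variable {A : Matrix (Fin 4) (Fin (4 + 1)) ℝ} {k : Fin (4 + 1) → ℝ}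

theorem mulVec_surjective (h : IsProjectionFrom A k) : Function.Surjective A.mulVec :=
  rank_eq_card_iff_surjective.1 (by simpa using h.rank_eq)

theorem coeffLin_eq_zero (h : IsProjectionFrom A k) : coeffLin A (complexify k) = 0 := by
  rw [coeffLin_complexify, h.mulVec_eq_zero, map_zero]

theorem exists_eq_smul (h : IsProjectionFrom A k) {v : Fin (4 + 1) → ℂ} (hv : coeffLin A v = 0) :
    ∃ c : ℂ, v = c • complexify k :=
  exists_eq_smul_of_finrank_ker_eq_one
    (by
      rw [coeffLin, finrank_ker_mulVecLin (map_ofReal_mulVec_surjective h.mulVec_surjective)]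
      simp)
    (complexify_ne_zero.2 h.ne_zero) h.coeffLin_eq_zero hv

theorem paramMap_eq_zero_iff (h : IsProjectionFrom A k) {z : Fin 2 → ℂ} (hz : z ≠ 0) :
    paramMap A z = 0 ↔ contract z (complexify k) = 0 := by
  constructor
  · intro hA
    obtain ⟨c, hc⟩ := h.exists_eq_smul (v := veroneseVec 4 z) hA
    have hc0 : c ≠ 0 := fun hc0 => veroneseVec_ne_zero hz (hc.trans (by rw [hc0, zero_smul]))
    have hcz := congrArg (contract z) hc
    rw [contract_veroneseVec, bracket_self, zero_smul, map_smul] at hcz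
    exact (smul_eq_zero.1 hcz.symm).resolve_left hc0
  · intro hk
    obtain ⟨a, ha⟩ := exists_eq_smul_veroneseVec hz hk
    have ha0 : a ≠ 0 := fun ha0 =>
      complexify_ne_zero.2 h.ne_zero (ha.trans (by rw [ha0, zero_smul]))
    have haz := h.coeffLin_eq_zero
    rw [ha, map_smul, coeffLin_veroneseVec] at haz
    exact (smul_eq_zero.1 haz).resolve_left ha0

theorem isRationalQuartic_iff (h : IsProjectionFrom A k) :
    IsRationalQuartic A ↔ OffNormalCurve (complexify k) := by
  rw [IsRationalQuartic, and_iff_right h.rank_eq]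
  refine forall_congr' fun z => ?_
  by_cases hz : z = 0
  · simp [hz]
  · simp [hz, h.paramMap_eq_zero_iff hz]

theorem injective_fderiv_iff (h : IsProjectionFrom A k) {z : Fin 2 → ℂ} (hz : z ≠ 0) :
    Function.Injective (fderiv ℂ (paramMap A) z) ↔
      contract z (contract z (complexify k)) ≠ 0 := by
  rw [injective_iff_map_eq_zero]
  constructor
  · intro hinj hk
    obtain ⟨g, hg⟩ := exists_eq_fderiv_veroneseVec hz hk
    have hg0 : g = 0 := hinj g (by rw [fderiv_paramMap, ← hg, h.coeffLin_eq_zero])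
    exact complexify_ne_zero.2 h.ne_zero (by rw [hg, hg0, map_zero])
  · intro hk g hg
    rw [fderiv_paramMap] at hg
    obtain ⟨c, hc⟩ := h.exists_eq_smul hg
    have hc0 : c = 0 := by
      have hcz := congrArg (fun v => contract z (contract z v)) hc
      simp only [contract_fderiv_veroneseVec, contract_veroneseVec, bracket_self, map_smul,
        zero_smul, smul_zero, add_zero] at hcz
      exact (smul_eq_zero.1 hcz.symm).resolve_right hk
    rw [hc0, zero_smul] at hc
    exact eq_zero_of_fderiv_veroneseVec_eq_zero hz hc

theorem exists_paramMap_eq_smul_iff (h : IsProjectionFrom A k)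
    (hk : OffNormalCurve (complexify k)) {z w : Fin 2 → ℂ} (hzw : bracket z w ≠ 0) :
    (∃ c : ℂ, c ≠ 0 ∧ paramMap A z = c • paramMap A w) ↔
      contract z (contract w (complexify k)) = 0 := by
  constructor
  · rintro ⟨c, -, hc⟩
    have hker : coeffLin A (veroneseVec 4 z - c • veroneseVec 4 w) = 0 := by
      rw [map_sub, map_smul, coeffLin_veroneseVec, coeffLin_veroneseVec, hc, sub_self]
    obtain ⟨a, ha⟩ := h.exists_eq_smul hker
    have ha0 : a ≠ 0 := by
      rintro rfl
      rw [zero_smul, sub_eq_add_neg, ← neg_smul, ← one_smul ℂ (veroneseVec 4 z)] at ha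
      exact one_ne_zero (eq_zero_of_smul_veroneseVec_add hzw ha).1
    have hzwk := congrArg (fun v => contract z (contract w v)) ha
    simp only [map_sub, map_smul, contract_veroneseVec, bracket_self, zero_smul, smul_zero,
      sub_zero] at hzwk
    exact (smul_eq_zero.1 hzwk.symm).resolve_left ha0
  · intro hzwk
    obtain ⟨α, β, hα, hβ, hαβ⟩ := hk.exists_eq_veroneseVec_add hzw hzwk
    have hker := h.coeffLin_eq_zero
    rw [hαβ, map_add, map_smul, map_smul, coeffLin_veroneseVec, coeffLin_veroneseVec] at hker
    refine ⟨α⁻¹ * -β, mul_ne_zero (inv_ne_zero hα) (neg_ne_zero.2 hβ), ?_⟩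
    rw [mul_smul, neg_smul, ← eq_neg_of_add_eq_zero_left hker, smul_smul, inv_mul_cancel₀ hα,
      one_smul]

theorem isEmbeddedCurve_iff (h : IsProjectionFrom A k) (hk : OffNormalCurve (complexify k)) :
    IsEmbeddedCurve A ↔ ¬OnSecantVariety (complexify k) := by
  constructor
  · rintro ⟨hinj, himm⟩ ⟨z, w, hz, hw, hzwk⟩
    by_cases hzw : bracket z w = 0
    · obtain ⟨c, rfl⟩ := exists_eq_smul_of_bracket_eq_zero hw hzw
      rw [map_smul, LinearMap.smul_apply, smul_eq_zero, or_iff_right fun hc => hz (by simp [hc])]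
        at hzwk
      exact (h.injective_fderiv_iff hw).1 (himm w hw) hzwk
    · obtain ⟨c, -, rfl⟩ := hinj z w hz hw ((h.exists_paramMap_eq_smul_iff hk hzw).2 hzwk)
      simp at hzw
  · intro hsec
    refine ⟨fun z w hz hw hzw => ?_, fun z hz =>
      (h.injective_fderiv_iff hz).2 fun hzz => hsec ⟨z, z, hz, hz, hzz⟩⟩
    have hbr : bracket z w = 0 := by
      by_contra hbr
      exact hsec ⟨z, w, hz, hw, (h.exists_paramMap_eq_smul_iff hk hbr).1 hzw⟩
    obtain ⟨c, rfl⟩ := exists_eq_smul_of_bracket_eq_zero hw hbr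
    exact ⟨c, fun hc => hz (by simp [hc]), rfl⟩

end IsProjectionFrom

theorem IsTwistedCubic.mulVec_surjective {B : Matrix (Fin 4) (Fin (3 + 1)) ℝ}
    (hB : IsTwistedCubic B) : Function.Surjective B.mulVec :=
  rank_eq_card_iff_surjective.1 (hB.trans (Fintype.card_fin 4).symm)

theorem IsTwistedCubic.mulVec_injective {B : Matrix (Fin 4) (Fin (3 + 1)) ℝ}
    (hB : IsTwistedCubic B) : Function.Injective B.mulVec :=
  LinearMap.injective_iff_surjective (f := B.mulVecLin).2 hB.mulVec_surjective

theorem IsTwistedCubic.coeffLin_injective {B : Matrix (Fin 4) (Fin (3 + 1)) ℝ}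
    (hB : IsTwistedCubic B) : Function.Injective (coeffLin B) :=
  LinearMap.injective_iff_surjective.2 (map_ofReal_mulVec_surjective hB.mulVec_surjective)

theorem IsTwistedCubic.paramMap_ne_zero {B : Matrix (Fin 4) (Fin (3 + 1)) ℝ}
    (hB : IsTwistedCubic B) (z : Fin 2 → ℂ) (hz : z ≠ 0) : paramMap B z ≠ 0 := fun h =>
  veroneseVec_ne_zero hz (hB.coeffLin_injective (h.trans (map_zero _).symm))

/-- The line in `ℙ³` formed by the contractions of `k` with all linear forms. -/
noncomputable def contractionLine (B : Matrix (Fin 4) (Fin (d + 1)) ℝ) (k : Fin (d + 2) → ℂ) :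
    Submodule ℂ (Fin 4 → ℂ) :=
  LinearMap.range (coeffLin B ∘ₗ contract.flip k)

theorem mem_contractionLine {B : Matrix (Fin 4) (Fin (d + 1)) ℝ} {k : Fin (d + 2) → ℂ}
    {v : Fin 4 → ℂ} : v ∈ contractionLine B k ↔ ∃ x, coeffLin B (contract x k) = v :=
  Iff.rfl

section ContractionLine

variable {B : Matrix (Fin 4) (Fin (3 + 1)) ℝ} {k : Fin (4 + 1) → ℂ}

theorem finrank_contractionLine (hB : IsTwistedCubic B) (hk : OffNormalCurve k) :
    Module.finrank ℂ (contractionLine B k) = 2 := by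
  rw [contractionLine, LinearMap.finrank_range_of_inj, Module.finrank_fin_fun]
  exact hB.coeffLin_injective.comp ((injective_iff_map_eq_zero _).2 hk)

theorem disjoint_contractionLine_iff (hB : IsTwistedCubic B) (hk : OffNormalCurve k) :
    Disjoint (linePoints (contractionLine B k)) (curve B) ↔ ¬OnSecantVariety k := by
  rw [Set.disjoint_right]
  constructor
  · rintro h ⟨z, w, hz, hw, hzw⟩
    obtain ⟨a, ha0, ha⟩ := hk.exists_contract_eq hz hw hzw
    have hz' := hB.paramMap_ne_zero z hz
    refine h ⟨z, hz, hz', rfl⟩ ((mk_mem_linePoints hz').2 ?_)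
    refine mem_contractionLine.2 ⟨a⁻¹ • w, ?_⟩
    rw [map_smul, LinearMap.smul_apply, ha, smul_smul, inv_mul_cancel₀ ha0, one_smul,
      coeffLin_veroneseVec]
  · rintro h _ ⟨z, hz, hz', rfl⟩ hmem
    obtain ⟨w, hw⟩ := mem_contractionLine.1 ((mk_mem_linePoints hz').1 hmem)
    have hzw : contract w k = veroneseVec 3 z := hB.coeffLin_injective hw
    refine h ⟨z, w, hz, ?_, ?_⟩
    · rintro rfl
      rw [map_zero, LinearMap.zero_apply] at hzw
      exact veroneseVec_ne_zero hz hzw.symm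
    · rw [hzw, contract_veroneseVec, bracket_self, zero_smul]

theorem contractionLine_eq_tangent (hB : IsTwistedCubic B) (hk : OffNormalCurve k) {z : Fin 2 → ℂ}
    (hz : z ≠ 0) (h : contract z (contract z k) = 0) :
    contractionLine B k = LinearMap.range (fderiv ℂ (paramMap B) z).toLinearMap := by
  obtain ⟨g, rfl⟩ := exists_eq_fderiv_veroneseVec hz h
  apply Submodule.eq_of_le_of_finrank_le
  · intro _ hv
    obtain ⟨x, rfl⟩ := mem_contractionLine.1 hv
    refine ⟨(bracket x g / 3) • z + bracket x z • g, ?_⟩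
    rw [ContinuousLinearMap.coe_coe, fderiv_paramMap, map_add, map_smul, map_smul,
      fderiv_veroneseVec_self, smul_smul, Nat.cast_ofNat, div_mul_cancel₀ _ (by norm_num),
      ← contract_fderiv_veroneseVec]
  · rw [finrank_contractionLine hB hk]
    exact (LinearMap.finrank_range_le _).trans (by simp)

theorem contractionLine_eq_chord (hB : IsTwistedCubic B) (hk : OffNormalCurve k)
    {z w : Fin 2 → ℂ} (hzw : bracket z w ≠ 0) (h : contract z (contract w k) = 0) :
    contractionLine B k = Submodule.span ℂ {paramMap B z, paramMap B w} := by
  obtain ⟨α, β, -, -, rfl⟩ := hk.exists_eq_veroneseVec_add hzw h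
  apply Submodule.eq_of_le_of_finrank_le
  · intro _ hv
    obtain ⟨x, rfl⟩ := mem_contractionLine.1 hv
    refine Submodule.mem_span_pair.2 ⟨α * bracket x z, β * bracket x w, ?_⟩
    simp only [map_add, map_smul, contract_veroneseVec,
      coeffLin_veroneseVec, smul_smul]
  · rw [finrank_contractionLine hB hk]
    classical
    refine (finrank_span_le_card ({paramMap B z, paramMap B w} : Set (Fin 4 → ℂ))).trans ?_
    rw [Set.toFinset_insert, Set.toFinset_singleton]
    exact Finset.card_le_two

theorem isSecantLine_contractionLine (hB : IsTwistedCubic B) (hk : OffNormalCurve k)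
    (h : OnSecantVariety k) : IsSecantLine B (contractionLine B k) := by
  refine ⟨finrank_contractionLine hB hk, ?_⟩
  obtain ⟨z, w, hz, hw, h⟩ := h
  by_cases hzw : bracket z w = 0
  · obtain ⟨c, rfl⟩ := exists_eq_smul_of_bracket_eq_zero hw hzw
    rw [map_smul, LinearMap.smul_apply, smul_eq_zero, or_iff_right fun hc => hz (by simp [hc])] at h
    exact Or.inr ⟨w, hw, contractionLine_eq_tangent hB hk hw h⟩
  · exact Or.inl ⟨z, w, linearIndependent_of_bracket_ne_zero hzw,
      contractionLine_eq_chord hB hk hzw h⟩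

end ContractionLine

theorem IsSecantLine.exists_contract_contract_eq_zero {B : Matrix (Fin 4) (Fin (3 + 1)) ℝ}
    (hB : IsTwistedCubic B) {L : Submodule ℂ (Fin 4 → ℂ)} (hL : IsSecantLine B L) :
    ∃ z w : Fin 2 → ℂ, z ≠ 0 ∧ w ≠ 0 ∧
      ∀ p, coeffLin B p ∈ L → contract z (contract w p) = 0 := by
  obtain ⟨-, ⟨z, w, hzw, rfl⟩ | ⟨z, hz, rfl⟩⟩ := hL
  · refine ⟨z, w, hzw.ne_zero 0, hzw.ne_zero 1, fun p hp => ?_⟩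
    obtain ⟨a, b, hab⟩ := Submodule.mem_span_pair.1 hp
    rw [← coeffLin_veroneseVec, ← coeffLin_veroneseVec, ← map_smul, ← map_smul, ← map_add] at hab
    simp only [← hB.coeffLin_injective hab, map_add, map_smul, contract_veroneseVec, bracket_self,
      zero_smul, smul_zero, add_zero]
  · refine ⟨z, z, hz, hz, fun p ⟨g, hg⟩ => ?_⟩
    rw [ContinuousLinearMap.coe_coe, fderiv_paramMap] at hg
    rw [← hB.coeffLin_injective hg, contract_fderiv_veroneseVec, bracket_self, zero_smul, add_zero,
      map_smul, contract_veroneseVec, bracket_self, zero_smul, smul_zero]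

end Curves

section Companion

variable {A : Matrix (Fin 4) (Fin (4 + 1)) ℝ} {B : Matrix (Fin 4) (Fin (3 + 1)) ℝ}
  {k : Fin (4 + 1) → ℝ} {P P₁ P₂ Q Q₁ Q₂ : Camera} {w w₁ w₂ : Fin 2 → ℂ}

theorem bracket_eq_zero_of_contract_eq_smul {d : ℕ} {k : Fin (d + 4) → ℂ} {x y z w : Fin 2 → ℂ}
    {a b : ℂ} (hzw : bracket z w ≠ 0) (hb : b ≠ 0)
    (hx : contract x k = a • veroneseVec (d + 2) z)
    (hy : contract y k = b • veroneseVec (d + 2) w) : bracket x w = 0 := by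
  have hxy := contract_comm x y k
  rw [hx, hy, map_smul, map_smul, contract_veroneseVec, contract_veroneseVec, smul_smul, smul_smul,
    eq_comm, ← sub_eq_zero, sub_eq_add_neg, ← neg_smul] at hxy
  exact (mul_eq_zero.1 (neg_eq_zero.1 (eq_zero_of_smul_veroneseVec_add hzw hxy).2)).resolve_left hb

theorem Camera.ker_le_contractionLine {k : Fin (4 + 1) → ℂ} (hB : IsTwistedCubic B)
    (hk : OffNormalCurve k) (hw : w ≠ 0) (hQ : Q.toLin (coeffLin B (contract w k)) = 0) :
    Q.toLin.ker ≤ contractionLine B k := by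
  intro v hv
  have hne : coeffLin B (contract w k) ≠ 0 := fun h =>
    hw (hk w (hB.coeffLin_injective (h.trans (map_zero _).symm)))
  obtain ⟨c, rfl⟩ := Q.exists_eq_smul hne hQ hv
  exact Submodule.smul_mem _ c (mem_contractionLine.2 ⟨w, rfl⟩)

/-- Cameras `P` and `Q` are companions if the projection of the quartic `A` by `P` is the
projection of the cubic `B` by `Q`, multiplied by the linear form with zero `w`.  This is stated on
the dual binary forms, which span the points of the curves. -/
structure IsCompanion (A : Matrix (Fin 4) (Fin (4 + 1)) ℝ) (B : Matrix (Fin 4) (Fin (3 + 1)) ℝ)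
    (w : Fin 2 → ℂ) (P Q : Camera) : Prop where
  ne_zero : w ≠ 0
  toLin_eq : ∀ v, P.toLin (coeffLin A v) = Q.toLin (coeffLin B (contract w v))

namespace IsCompanion

theorem toLin_paramMap (h : IsCompanion A B w P Q) (z : Fin 2 → ℂ) :
    P.toLin (paramMap A z) = bracket w z • Q.toLin (paramMap B z) := by
  rw [← coeffLin_veroneseVec, h.toLin_eq, contract_veroneseVec, map_smul, map_smul,
    coeffLin_veroneseVec]

theorem toLin_paramMap_self (h : IsCompanion A B w P Q) : P.toLin (paramMap A w) = 0 := by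
  rw [h.toLin_paramMap, bracket_self, zero_smul]

theorem haveCommonImage (h : IsCompanion A B w P Q) {z : Fin 2 → ℂ} (hA : paramMap A z ≠ 0)
    (hB : paramMap B z ≠ 0) :
    HaveCommonImage P Q (Projectivization.mk ℂ _ hA) (Projectivization.mk ℂ _ hB) :=
  haveCommonImage_mk hA hB (h.toLin_paramMap z) (one_smul ℂ _).symm

theorem toLin_contract (h : IsCompanion A B w P Q) (hA : IsProjectionFrom A k) :
    Q.toLin (coeffLin B (contract w (complexify k))) = 0 := by
  rw [← h.toLin_eq, hA.coeffLin_eq_zero, map_zero]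

theorem ker_le_contractionLine (h : IsCompanion A B w P Q) (hA : IsProjectionFrom A k)
    (hk : OffNormalCurve (complexify k)) (hB : IsTwistedCubic B) :
    Q.toLin.ker ≤ contractionLine B (complexify k) :=
  Camera.ker_le_contractionLine hB hk h.ne_zero (h.toLin_contract hA)

theorem toLin_paramMap_ne_zero (h : IsCompanion A B w P Q) (hA : IsRationalQuartic A)
    (hP : P.center ≠ P₂.center) : P₂.toLin (paramMap A w) ≠ 0 := fun h0 =>
  hP ((Camera.center_eq_iff (hA.2 w h.ne_zero) h.toLin_paramMap_self).2 h0)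

theorem exists_contract_eq_of_center_mem_curve (h : IsCompanion A B w P Q)
    (hA : IsProjectionFrom A k) (hk : OffNormalCurve (complexify k)) (hB : IsTwistedCubic B)
    (hQ : Q.center ∈ curve B) : ∃ (z : Fin 2 → ℂ) (a : ℂ), z ≠ 0 ∧ a ≠ 0 ∧
      Q.toLin (paramMap B z) = 0 ∧ contract w (complexify k) = a • veroneseVec 3 z := by
  obtain ⟨z, hz, hz', hzQ⟩ := hQ
  have hzQ' := (Q.center_eq_mk_iff hz').1 hzQ
  obtain ⟨a, ha⟩ := Q.exists_eq_smul hz' hzQ' (h.toLin_contract hA)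
  rw [← coeffLin_veroneseVec, ← map_smul] at ha
  have hcontract := hB.coeffLin_injective ha
  refine ⟨z, a, hz, ?_, hzQ', hcontract⟩
  rintro rfl
  exact h.ne_zero (hk w (hcontract.trans (zero_smul ℂ _)))

section Pair

variable (h₁ : IsCompanion A B w₁ P₁ Q₁) (h₂ : IsCompanion A B w₂ P₂ Q₂)
  (hA : IsProjectionFrom A k) (hk : OffNormalCurve (complexify k)) (hP : P₁.center ≠ P₂.center)
include h₁ h₂ hA hk hP

theorem bracket_ne_zero : bracket w₁ w₂ ≠ 0 := by
  have h := h₁.toLin_paramMap_ne_zero (hA.isRationalQuartic_iff.2 hk) hP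
  rw [h₂.toLin_paramMap] at h
  exact bracket_ne_zero_comm.1 (left_ne_zero_of_smul h)

theorem contract_contract_ne_zero : contract w₁ (contract w₂ (complexify k)) ≠ 0 := by
  intro h
  obtain ⟨c, -, hc⟩ :=
    (hA.exists_paramMap_eq_smul_iff hk (h₁.bracket_ne_zero h₂ hA hk hP)).2 h
  refine h₁.toLin_paramMap_ne_zero (hA.isRationalQuartic_iff.2 hk) hP ?_
  rw [hc, map_smul, h₂.toLin_paramMap_self, smul_zero]

theorem center_ne (hB : IsTwistedCubic B) : Q₁.center ≠ Q₂.center := by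
  intro h
  have hne : coeffLin B (contract w₁ (complexify k)) ≠ 0 := fun h0 =>
    h₁.ne_zero (hk w₁ (hB.coeffLin_injective (h0.trans (map_zero _).symm)))
  have hQ₂ := (Camera.center_eq_iff hne (h₁.toLin_contract hA)).1 h
  obtain ⟨c, hc⟩ := Q₂.exists_eq_smul hne hQ₂ (h₂.toLin_contract hA)
  rw [← map_smul, ← LinearMap.smul_apply, ← map_smul] at hc
  have hw := hk (w₂ - c • w₁) (by
    rw [map_sub, LinearMap.sub_apply, hB.coeffLin_injective hc, sub_self])
  apply h₁.bracket_ne_zero h₂ hA hk hP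
  rw [sub_eq_zero.1 hw, map_smul, bracket_self, smul_zero]

theorem distinguishable_of_notMem (hB : IsTwistedCubic B)
    (hmem : paramMap B w₁ ∉ contractionLine B (complexify k)) :
    Distinguishable P₁ P₂ Q₁ Q₂ := by
  have hbr := bracket_ne_zero_comm.1 (h₁.bracket_ne_zero h₂ hA hk hP)
  refine distinguishable_of_epipole (c := paramMap A w₁) (u := bracket w₂ w₁ • paramMap B w₁)
    ((hA.isRationalQuartic_iff.2 hk).2 w₁ h₁.ne_zero) h₁.toLin_paramMap_self ?_
    (h₁.center_ne h₂ hA hk hP hB) fun hu => hmem ?_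
  · rw [h₂.toLin_paramMap, map_smul]
  · exact (Submodule.smul_mem_iff _ hbr).1 (sup_le (h₁.ker_le_contractionLine hA hk hB)
      (h₂.ker_le_contractionLine hA hk hB) hu)

theorem paramMap_notMem_contractionLine (hB : IsTwistedCubic B)
    (hmem : paramMap B w₁ ∈ contractionLine B (complexify k)) :
    paramMap B w₂ ∉ contractionLine B (complexify k) := by
  intro hmem₂
  obtain ⟨x, hx⟩ := mem_contractionLine.1 hmem
  obtain ⟨y, hy⟩ := mem_contractionLine.1 hmem₂
  have hx' : contract x (complexify k) = (1 : ℂ) • veroneseVec 3 w₁ := by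
    rw [one_smul]; exact hB.coeffLin_injective hx
  have hy' : contract y (complexify k) = (1 : ℂ) • veroneseVec 3 w₂ := by
    rw [one_smul]; exact hB.coeffLin_injective hy
  obtain ⟨c, rfl⟩ := exists_eq_smul_of_bracket_eq_zero h₂.ne_zero
    (bracket_eq_zero_of_contract_eq_smul (h₁.bracket_ne_zero h₂ hA hk hP) one_ne_zero hx' hy')
  rw [map_smul, LinearMap.smul_apply, one_smul] at hx'
  have hc : c ≠ 0 := by
    rintro rfl
    exact veroneseVec_ne_zero h₁.ne_zero (hx'.symm.trans (zero_smul ℂ _))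
  have h0 := congrArg (contract w₁) hx'
  rw [map_smul, contract_veroneseVec, bracket_self, zero_smul, smul_eq_zero, or_iff_right hc] at h0
  exact h₁.contract_contract_ne_zero h₂ hA hk hP h0

theorem distinguishable (hB : IsTwistedCubic B) : Distinguishable P₁ P₂ Q₁ Q₂ := by
  by_cases hmem : paramMap B w₁ ∈ contractionLine B (complexify k)
  · exact (h₂.distinguishable_of_notMem h₁ hA hk hP.symm hB
      (h₁.paramMap_notMem_contractionLine h₂ hA hk hP hB hmem)).swap
  · exact h₁.distinguishable_of_notMem h₂ hA hk hP hB hmem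

theorem center_notMem_curve (hB : IsTwistedCubic B) (hQ₁ : Q₁.center ∈ curve B) :
    Q₂.center ∉ curve B := by
  intro hQ₂
  obtain ⟨z, a, hz, -, hzQ, ha⟩ := h₁.exists_contract_eq_of_center_mem_curve hA hk hB hQ₁
  obtain ⟨y, b, hy, hb0, hyQ, hb⟩ := h₂.exists_contract_eq_of_center_mem_curve hA hk hB hQ₂
  have hzy : bracket z y ≠ 0 := by
    intro hzy
    obtain ⟨c, rfl⟩ := exists_eq_smul_of_bracket_eq_zero hy hzy
    refine h₁.center_ne h₂ hA hk hP hB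
      ((Camera.center_eq_iff (hB.paramMap_ne_zero _ hz) hzQ).2 ?_)
    rw [paramMap_smul, map_smul, hyQ, smul_zero]
  obtain ⟨c, hc⟩ := exists_eq_smul_of_bracket_eq_zero hy
    (bracket_eq_zero_of_contract_eq_smul hzy hb0 ha hb)
  apply h₁.contract_contract_ne_zero h₂ hA hk hP
  rw [hc, hb, map_smul, map_smul, LinearMap.smul_apply, contract_veroneseVec, bracket_self,
    zero_smul, smul_zero, smul_zero]

end Pair

end IsCompanion

section Tuple

variable {n : ℕ} {P Q : CameraTuple n} {w : Fin n → Fin 2 → ℂ}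
  (h : ∀ i, IsCompanion A B (w i) (P.cam i) (Q.cam i)) (hA : IsProjectionFrom A k)
  (hk : OffNormalCurve (complexify k)) (hB : IsTwistedCubic B)
include h hA hk hB

theorem centersIn_contractionLine_of_isCompanion :
    Q.CentersIn (linePoints (contractionLine B (complexify k))) := fun i =>
  Camera.center_mem_linePoints_iff.2 ((h i).ker_le_contractionLine hA hk hB)

theorem atMostOneCenterIn_of_isCompanion : Q.AtMostOneCenterIn (curve B) := by
  intro i j hi hj
  by_contra hij
  exact (h i).center_notMem_curve (h j) hA hk (P.distinct.ne hij) hB hi hj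

theorem conjugateAlong_of_isCompanion (hn : 2 ≤ n) :
    ConjugateAlong P (curve A) Q (curve B) ∧ ConjugateAlong Q (curve B) P (curve A) := by
  have hD (i j) (hij : i ≠ j) : Distinguishable (P.cam i) (P.cam j) (Q.cam i) (Q.cam j) :=
    (h i).distinguishable (h j) hA hk (P.distinct.ne hij) hB
  have hA' := (hA.isRationalQuartic_iff.2 hk).2
  have hI (i) (z : {z : Fin 2 → ℂ // z ≠ 0}) :=
    (h i).haveCommonImage (hA' z z.2) (hB.paramMap_ne_zero z z.2)
  rw [curve_eq_range hA', curve_eq_range hB.paramMap_ne_zero]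
  exact ⟨conjugateAlong_range hn hI hD,
    conjugateAlong_range hn (fun i z => (hI i z).symm) fun i j hij => (hD i j hij).symm⟩

end Tuple

end Companion

/-! ### Real points of the curves -/

section RealPoints

variable {d : ℕ}

theorem contract_complexify (w : Fin 2 → ℝ) (v : Fin (d + 2) → ℝ) :
    contract (complexify w) (complexify v) = complexify (contract w v) := by
  ext i
  simp only [contract_apply, complexify_apply, Complex.ofReal_sub, Complex.ofReal_mul]

theorem veroneseVec_complexify (z : Fin 2 → ℝ) :
    veroneseVec d (complexify z) = complexify (veroneseVec d z) := by
  ext i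
  simp only [veroneseVec, complexify_apply, Complex.ofReal_mul, Complex.ofReal_pow]

theorem paramMap_complexify (A : Matrix (Fin 4) (Fin (d + 1)) ℝ) (z : Fin 2 → ℝ) :
    paramMap A (complexify z) = complexify (A *ᵥ veroneseVec d z) := by
  rw [← coeffLin_veroneseVec, veroneseVec_complexify, coeffLin_complexify]

theorem star_contract (w : Fin 2 → ℂ) (v : Fin (d + 2) → ℂ) :
    star (contract w v) = contract (star w) (star v) := by
  ext i
  simp only [contract_apply, Pi.star_apply, star_sub, star_mul']

theorem star_veroneseVec (z : Fin 2 → ℂ) : star (veroneseVec d z) = veroneseVec d (star z) := by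
  ext i
  simp only [veroneseVec, Pi.star_apply, star_mul', star_pow]

theorem star_coeffLin (A : Matrix (Fin 4) (Fin (d + 1)) ℝ) (v : Fin (d + 1) → ℂ) :
    star (coeffLin A v) = coeffLin A (star v) :=
  star_map_ofReal_mulVec A v

theorem star_paramMap (A : Matrix (Fin 4) (Fin (d + 1)) ℝ) (z : Fin 2 → ℂ) :
    star (paramMap A z) = paramMap A (star z) := by
  rw [← coeffLin_veroneseVec, star_coeffLin, star_veroneseVec, coeffLin_veroneseVec]

theorem exists_eq_smul_complexify {u : Fin 2 → ℂ} (hu : u ≠ 0) (h : bracket u (star u) = 0) :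
    ∃ (w : Fin 2 → ℝ) (c : ℂ), w ≠ 0 ∧ c ≠ 0 ∧ u = c • complexify w := by
  obtain ⟨i, hi⟩ := Function.ne_iff.1 hu
  obtain ⟨w, hw⟩ : ∃ w, complexify w = (u i)⁻¹ • u := by
    obtain ⟨c, hc⟩ := exists_eq_smul_of_bracket_eq_zero hu (by rw [bracket_swap, h, neg_zero])
    have hc0 : c ≠ 0 := by
      rintro rfl
      exact hu (star_eq_zero.1 (hc.trans (zero_smul ℂ u)))
    have hci : star (u i) = c * u i := congrFun hc i
    apply exists_complexify_eq_of_star_eq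
    rw [star_smul, star_inv₀, hci, hc, smul_smul, mul_inv_rev, mul_assoc, inv_mul_cancel₀ hc0,
      mul_one]
  have heq : u = u i • complexify w := by rw [hw, smul_smul, mul_inv_cancel₀ hi, one_smul]
  refine ⟨w, u i, ?_, hi, heq⟩
  rintro rfl
  exact hu (by rw [heq, map_zero, smul_zero])

theorem Camera.toLin_paramMap_star {A : Matrix (Fin 4) (Fin (d + 1)) ℝ} {P : Camera}
    {u : Fin 2 → ℂ} (h : P.toLin (paramMap A u) = 0) : P.toLin (paramMap A (star u)) = 0 := by
  rw [← star_paramMap, ← P.star_toLin, h, star_zero]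

theorem Camera.exists_real_or_conj_of_center_mem_curve {A : Matrix (Fin 4) (Fin (d + 1)) ℝ}
    {P : Camera} (hP : P.center ∈ curve A) :
    (∃ w : Fin 2 → ℝ, w ≠ 0 ∧ P.toLin (paramMap A (complexify w)) = 0) ∨
    ∃ u : Fin 2 → ℂ, bracket u (star u) ≠ 0 ∧ P.toLin (paramMap A u) = 0 := by
  obtain ⟨u, hu, hu', h⟩ := hP
  have hPu := (P.center_eq_mk_iff hu').1 h
  by_cases hs : bracket u (star u) = 0
  · obtain ⟨w, c, hw, hc, rfl⟩ := exists_eq_smul_complexify hu hs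
    rw [paramMap_smul, map_smul, smul_eq_zero] at hPu
    exact Or.inl ⟨w, hw, hPu.resolve_left (pow_ne_zero _ hc)⟩
  · exact Or.inr ⟨u, hs, hPu⟩

theorem Camera.exists_real_of_center_mem_realBranch {A : Matrix (Fin 4) (Fin (d + 1)) ℝ}
    {P : Camera} (hP : P.center ∈ realBranch A) :
    ∃ w : Fin 2 → ℝ, w ≠ 0 ∧ P.toLin (paramMap A (complexify w)) = 0 := by
  obtain ⟨w, hw, hw', h⟩ := hP
  exact ⟨w, hw, (P.center_eq_mk_iff hw').1 h⟩

end RealPoints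

section CompanionExistence

variable {A : Matrix (Fin 4) (Fin (4 + 1)) ℝ} {B : Matrix (Fin 4) (Fin (3 + 1)) ℝ}
  {k : Fin (4 + 1) → ℝ}

theorem isCompanion_of_real {P Q : Camera} {w : Fin 2 → ℝ} (hw : w ≠ 0)
    (h : ∀ v, P.mat *ᵥ A *ᵥ v = Q.mat *ᵥ B *ᵥ contract w v) :
    IsCompanion A B (complexify w) P Q := by
  refine ⟨complexify_ne_zero.2 hw, fun v => ?_⟩
  refine LinearMap.congr_fun (f := P.toLin ∘ₗ coeffLin A)
    (g := Q.toLin ∘ₗ coeffLin B ∘ₗ contract (complexify w)) (linearMap_eq_of_complexify fun v => ?_)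
    v
  simp only [LinearMap.comp_apply, contract_complexify, coeffLin_complexify,
    Camera.toLin_complexify, h]

theorem exists_isCompanion_cubic (hA : IsRationalQuartic A) (hB : IsTwistedCubic B) {P : Camera}
    {w : Fin 2 → ℝ} (hw : w ≠ 0) (hP : P.toLin (paramMap A (complexify w)) = 0) :
    ∃ Q, IsCompanion A B (complexify w) P Q := by
  have hAsurj : Function.Surjective A.mulVec :=
    rank_eq_card_iff_surjective.1 (hA.1.trans (Fintype.card_fin 4).symm)
  rw [paramMap_complexify, P.toLin_complexify,
    map_eq_zero_iff _ complexify_injective] at hP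
  have hker : (B.mulVecLin ∘ₗ contract w).ker ≤ (P.mat.mulVecLin ∘ₗ A.mulVecLin).ker := by
    intro v hv
    obtain ⟨a, rfl⟩ := exists_eq_smul_veroneseVec hw
      (hB.mulVec_injective (hv.trans B.mulVec_zero.symm))
    exact Submodule.smul_mem _ a hP
  obtain ⟨Q, hQ⟩ := Camera.exists_mulVec_eq (P.mat_mulVec_surjective.comp hAsurj)
    (hB.mulVec_surjective.comp (contract_surjective hw)) hker
  exact ⟨Q, isCompanion_of_real hw fun v => (hQ v).symm⟩

theorem exists_isCompanion_quartic (hA : IsProjectionFrom A k) (hB : IsTwistedCubic B) {Q : Camera}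
    {w : Fin 2 → ℝ} (hw : w ≠ 0)
    (hQ : Q.toLin (coeffLin B (contract (complexify w) (complexify k))) = 0) :
    ∃ P, IsCompanion A B (complexify w) P Q := by
  rw [contract_complexify, coeffLin_complexify, Q.toLin_complexify,
    map_eq_zero_iff _ complexify_injective] at hQ
  have hker : A.mulVecLin.ker ≤ (Q.mat.mulVecLin ∘ₗ B.mulVecLin ∘ₗ contract w).ker := by
    intro v hv
    obtain ⟨c, rfl⟩ := exists_eq_smul_of_finrank_ker_eq_one
      (by rw [finrank_ker_mulVecLin hA.mulVec_surjective]; simp) hA.ne_zero hA.mulVec_eq_zero hv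
    exact Submodule.smul_mem _ c hQ
  obtain ⟨P, hP⟩ := Camera.exists_mulVec_eq
    ((Q.mat_mulVec_surjective.comp hB.mulVec_surjective).comp (contract_surjective hw))
    hA.mulVec_surjective hker
  exact ⟨P, isCompanion_of_real hw hP⟩

theorem isTwistedCubic_one : IsTwistedCubic (1 : Matrix (Fin 4) (Fin (3 + 1)) ℝ) :=
  Matrix.rank_one.trans (Fintype.card_fin 4)

theorem exists_isCompanion_cubicTuple {n : ℕ} (hA : IsProjectionFrom A k)
    (hk : OffNormalCurve (complexify k)) (hB : IsTwistedCubic B) {P : CameraTuple n}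
    (hP : ∀ i, ∃ w : Fin 2 → ℝ, w ≠ 0 ∧ (P.cam i).toLin (paramMap A (complexify w)) = 0) :
    ∃ (Q : CameraTuple n) (w : Fin n → Fin 2 → ℂ),
      ∀ i, IsCompanion A B (w i) (P.cam i) (Q.cam i) := by
  choose w hw hPw using hP
  choose Q hQ using fun i =>
    exists_isCompanion_cubic (hA.isRationalQuartic_iff.2 hk) hB (hw i) (hPw i)
  refine ⟨⟨Q, fun i j => not_imp_not.1 fun hij => ?_⟩, _, hQ⟩
  exact (hQ i).center_ne (hQ j) hA hk (P.distinct.ne hij) hB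

end CompanionExistence

/-! ### Cameras on a rational quartic -/

section Quartic

variable {n : ℕ} {A : Matrix (Fin 4) (Fin (4 + 1)) ℝ} {P : CameraTuple n}

theorem IsRationalQuartic.exists_paramMap_eq_smul (hA : IsRationalQuartic A) {P : Camera}
    {z w : Fin 2 → ℂ} (hz : z ≠ 0) (hw : w ≠ 0) (hPz : P.toLin (paramMap A z) = 0)
    (hPw : P.toLin (paramMap A w) = 0) : ∃ c : ℂ, c ≠ 0 ∧ paramMap A z = c • paramMap A w := by
  obtain ⟨c, hc⟩ := P.exists_eq_smul (hA.2 w hw) hPw hPz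
  refine ⟨c, ?_, hc⟩
  rintro rfl
  exact hA.2 z hz (hc.trans (zero_smul ℂ _))

theorem IsSmoothRationalQuartic.bracket_star_eq_zero (hA : IsSmoothRationalQuartic A) {P : Camera}
    {u : Fin 2 → ℂ} (hu : P.toLin (paramMap A u) = 0) : bracket u (star u) = 0 := by
  by_contra hne
  have hu0 := left_ne_zero_of_bracket_ne_zero hne
  have hu1 := right_ne_zero_of_bracket_ne_zero hne
  obtain ⟨a, -, ha⟩ := hA.2.1 u (star u) hu0 hu1
    (hA.1.exists_paramMap_eq_smul hu0 hu1 hu (Camera.toLin_paramMap_star hu))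
  refine hne ?_
  nth_rw 1 [ha]
  rw [map_smul, LinearMap.smul_apply, bracket_self, smul_zero]

theorem smoothQuartic_conjugateAlong (hn : 2 ≤ n) (hA : IsSmoothRationalQuartic A)
    (hP : P.CentersIn (curve A)) :
    ∃ (B : Matrix (Fin 4) (Fin (3 + 1)) ℝ) (L : Submodule ℂ (Fin 4 → ℂ)) (Q : CameraTuple n),
      IsTwistedCubic B ∧ IsLine L ∧ Disjoint (linePoints L) (curve B) ∧
      Q.CentersIn (linePoints L) ∧ ConjugateAlong P (curve A) Q (curve B) := by
  obtain ⟨k, hAk⟩ := exists_isProjectionFrom_of_rank_eq hA.1.1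
  have hk := hAk.isRationalQuartic_iff.1 hA.1
  have hB := isTwistedCubic_one
  obtain ⟨Q, w, hQ⟩ := exists_isCompanion_cubicTuple hAk hk hB (P := P) fun i =>
    (Camera.exists_real_or_conj_of_center_mem_curve (hP i)).resolve_right
      fun ⟨u, hne, hu⟩ => hne (hA.bracket_star_eq_zero hu)
  exact ⟨1, contractionLine 1 (complexify k), Q, hB, finrank_contractionLine hB hk,
    (disjoint_contractionLine_iff hB hk).2 ((hAk.isEmbeddedCurve_iff hk).1 hA.2),
    centersIn_contractionLine_of_isCompanion hQ hAk hk hB,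
    (conjugateAlong_of_isCompanion hQ hAk hk hB hn).1⟩

theorem singularQuartic_conjugateAlong (hn : 2 ≤ n) (hA : IsSingularRationalQuartic A)
    (hP : ∀ i, ∃ w : Fin 2 → ℝ, w ≠ 0 ∧ (P.cam i).toLin (paramMap A (complexify w)) = 0) :
    ∃ (B : Matrix (Fin 4) (Fin (3 + 1)) ℝ) (L : Submodule ℂ (Fin 4 → ℂ)) (Q : CameraTuple n),
      IsTwistedCubic B ∧ IsSecantLine B L ∧ Q.CentersIn (linePoints L) ∧
      Q.AtMostOneCenterIn (curve B) ∧ ConjugateAlong P (curve A) Q (curve B) := by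
  obtain ⟨k, hAk⟩ := exists_isProjectionFrom_of_rank_eq hA.1.1
  have hk := hAk.isRationalQuartic_iff.1 hA.1
  have hB := isTwistedCubic_one
  obtain ⟨Q, w, hQ⟩ := exists_isCompanion_cubicTuple hAk hk hB hP
  exact ⟨1, contractionLine 1 (complexify k), Q, hB,
    isSecantLine_contractionLine hB hk (not_not.1 fun h =>
      hA.2 ((hAk.isEmbeddedCurve_iff hk).2 h)),
    centersIn_contractionLine_of_isCompanion hQ hAk hk hB,
    atMostOneCenterIn_of_isCompanion hQ hAk hk hB,
    (conjugateAlong_of_isCompanion hQ hAk hk hB hn).1⟩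

end Quartic

/-! ### Conic images -/

/-- The composition of the contractions with `u` and with its conjugate, restricted to the real
vectors. -/
noncomputable def contractConj {d : ℕ} (u : Fin 2 → ℂ) :
    (Fin (d + 3) → ℝ) →ₗ[ℝ] (Fin (d + 1) → ℝ) :=
  contract (Complex.re ∘ u) ∘ₗ contract (Complex.re ∘ u) +
    contract (Complex.im ∘ u) ∘ₗ contract (Complex.im ∘ u)

theorem complexify_contractConj {d : ℕ} (u : Fin 2 → ℂ) (v : Fin (d + 3) → ℝ) :
    complexify (contractConj u v) = contract (star u) (contract u (complexify v)) := by
  ext i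
  apply Complex.ext <;>
  · simp [contractConj, contract_apply, complexify_apply]
    try ring

theorem contractConj_surjective {d : ℕ} {u : Fin 2 → ℂ} (hu : u ≠ 0) :
    Function.Surjective (contractConj (d := d) u) := by
  intro y
  obtain ⟨x', hx'⟩ := contract_surjective (star_ne_zero.2 hu) (complexify y)
  obtain ⟨x, rfl⟩ := contract_surjective hu x'
  have hstar : contract (star u) (contract u (star x)) = complexify y := by
    rw [← star_complexify, ← hx', star_contract, star_contract, star_star, contract_comm]
  obtain ⟨v, hv⟩ := exists_complexify_eq_of_star_eq (v := (2⁻¹ : ℂ) • (x + star x)) (by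
    rw [star_smul, star_add, star_star, add_comm (star x), star_inv₀, star_ofNat])
  refine ⟨v, complexify_injective ?_⟩
  rw [complexify_contractConj, hv, map_smul, map_smul, map_add, map_add, hx', hstar, ← two_smul ℂ,
    inv_smul_smul₀ two_ne_zero]

section Conic

variable {A : Matrix (Fin 4) (Fin (4 + 1)) ℝ} {B : Matrix (Fin 4) (Fin (3 + 1)) ℝ} {P Q : Camera}

theorem exists_conic_of_real_center (hB : IsTwistedCubic B) {u : Fin 2 → ℝ} (hu : u ≠ 0)
    (hQ : Q.toLin (paramMap B (complexify u)) = 0) :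
    ∃ N : Matrix (Fin 3) (Fin 3) ℝ, Function.Surjective N.mulVec ∧ ∀ z, Q.toLin (paramMap B z) =
      bracket (complexify u) z • N.map Complex.ofReal *ᵥ veroneseVec 2 z := by
  rw [paramMap_complexify, Q.toLin_complexify, map_eq_zero_iff _ complexify_injective] at hQ
  obtain ⟨N, hN, h⟩ := exists_matrix_mulVec_eq (f := Q.mat.mulVecLin ∘ₗ B.mulVecLin)
    (g := contract (d := 2) u) (Q.mat_mulVec_surjective.comp hB.mulVec_surjective)
    (contract_surjective hu) fun v hv => by
      obtain ⟨a, rfl⟩ := exists_eq_smul_veroneseVec hu hv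
      exact Submodule.smul_mem _ a hQ
  have hC : Q.toLin ∘ₗ coeffLin B =
      (N.map Complex.ofReal).mulVecLin ∘ₗ contract (complexify u) :=
    linearMap_eq_of_complexify fun v => by
      simp only [LinearMap.comp_apply, coeffLin_complexify, Camera.toLin_complexify,
        contract_complexify, Matrix.mulVecLin_apply, ← complexify_mulVec, h, Matrix.mulVecLin_apply]
  refine ⟨N, hN, fun z => ?_⟩
  rw [← coeffLin_veroneseVec, ← LinearMap.comp_apply, hC, LinearMap.comp_apply,
    contract_veroneseVec, map_smul, Matrix.mulVecLin_apply]

theorem exists_camera_of_conic (hB : IsTwistedCubic B) {t : Fin 2 → ℝ} (ht : t ≠ 0)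
    {N : Matrix (Fin 3) (Fin 3) ℝ} (hN : Function.Surjective N.mulVec) :
    ∃ Q : Camera, ∀ z, Q.toLin (paramMap B z) =
      bracket (complexify t) z • N.map Complex.ofReal *ᵥ veroneseVec 2 z := by
  obtain ⟨Q, h⟩ := Camera.exists_mulVec_eq (f := N.mulVecLin ∘ₗ contract (d := 2) t)
    (g := B.mulVecLin) (hN.comp (contract_surjective ht)) hB.mulVec_surjective fun v hv => by
      rw [hB.mulVec_injective (hv.trans B.mulVec_zero.symm)]
      exact zero_mem _
  have hC : Q.toLin ∘ₗ coeffLin B =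
      (N.map Complex.ofReal).mulVecLin ∘ₗ contract (complexify t) :=
    linearMap_eq_of_complexify fun v => by
      have hv : Q.mat *ᵥ B *ᵥ v = N *ᵥ contract t v := h v
      simp only [LinearMap.comp_apply, coeffLin_complexify, Camera.toLin_complexify,
        contract_complexify, Matrix.mulVecLin_apply, ← complexify_mulVec, hv]
  refine ⟨Q, fun z => ?_⟩
  rw [← coeffLin_veroneseVec, ← LinearMap.comp_apply, hC, LinearMap.comp_apply,
    contract_veroneseVec, map_smul, Matrix.mulVecLin_apply]

theorem exists_conic_of_conj_center (hA : A.rank = 4) {u : Fin 2 → ℂ} (hu : bracket u (star u) ≠ 0)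
    (hPu : P.toLin (paramMap A u) = 0) :
    ∃ N : Matrix (Fin 3) (Fin 3) ℝ, Function.Surjective N.mulVec ∧ ∀ z, P.toLin (paramMap A z) =
      (bracket (star u) z * bracket u z) • N.map Complex.ofReal *ᵥ veroneseVec 2 z := by
  have hAs : Function.Surjective A.mulVec :=
    rank_eq_card_iff_surjective.1 (hA.trans (Fintype.card_fin 4).symm)
  obtain ⟨N, hN, h⟩ := exists_matrix_mulVec_eq (f := P.mat.mulVecLin ∘ₗ A.mulVecLin)
    (g := contractConj (d := 2) u) (P.mat_mulVec_surjective.comp hAs)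
    (contractConj_surjective (left_ne_zero_of_bracket_ne_zero hu)) fun v hv => by
      have hv' : contract (star u) (contract u (complexify v)) = 0 := by
        rw [← complexify_contractConj, LinearMap.mem_ker.1 hv, map_zero]
      obtain ⟨α, β, hαβ⟩ :=
        exists_eq_veroneseVec_add_of_contract_contract (bracket_ne_zero_comm.1 hu) hv'
      apply complexify_injective
      simp only [LinearMap.comp_apply, Matrix.mulVecLin_apply, ← Camera.toLin_complexify,
        ← coeffLin_complexify, hαβ, map_add, map_smul, coeffLin_veroneseVec, hPu,
        Camera.toLin_paramMap_star hPu, smul_zero,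
        add_zero, map_zero]
  have hC : P.toLin ∘ₗ coeffLin A =
      (N.map Complex.ofReal).mulVecLin ∘ₗ contract (star u) ∘ₗ contract u :=
    linearMap_eq_of_complexify fun v => by
      simp only [LinearMap.comp_apply, coeffLin_complexify, Camera.toLin_complexify,
        ← complexify_contractConj, Matrix.mulVecLin_apply, ← complexify_mulVec, h]
  refine ⟨N, hN, fun z => ?_⟩
  rw [← coeffLin_veroneseVec, ← LinearMap.comp_apply, hC, LinearMap.comp_apply,
    LinearMap.comp_apply, contract_veroneseVec, map_smul, contract_veroneseVec, smul_smul,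
    map_smul, Matrix.mulVecLin_apply, mul_comm]

end Conic

section Chord

variable {B : Matrix (Fin 4) (Fin (3 + 1)) ℝ} {z w t : Fin 2 → ℂ}

theorem eq_zero_of_smul_paramMap_add_add (hB : IsTwistedCubic B) (hzw : bracket z w ≠ 0)
    (hzt : bracket z t ≠ 0) (hwt : bracket w t ≠ 0) {a b c : ℂ}
    (h : a • paramMap B z + b • paramMap B w + c • paramMap B t = 0) : a = 0 ∧ b = 0 ∧ c = 0 := by
  refine eq_zero_of_smul_veroneseVec_add_add (d := 1) hzw hzt hwt (hB.coeffLin_injective ?_)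
  simpa only [map_add, map_smul, coeffLin_veroneseVec, map_zero] using h

variable (hB : IsTwistedCubic B) (hzw : bracket z w ≠ 0) (hzt : bracket z t ≠ 0)
  (hwt : bracket w t ≠ 0) {Q₁ Q₂ : Camera} (hQ₁ : Q₁.toLin (paramMap B t) = 0) {a b : ℂ}
  (hb : b ≠ 0) (hQ₂ : Q₂.toLin (a • paramMap B z + b • paramMap B w) = 0)
include hB hzw hzt hwt hQ₁ hb hQ₂

theorem center_ne_of_mem_chord : Q₁.center ≠ Q₂.center := by
  intro h
  have ht := hB.paramMap_ne_zero t (right_ne_zero_of_bracket_ne_zero hzt)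
  obtain ⟨c, hc⟩ := Q₂.exists_eq_smul ht ((Camera.center_eq_iff ht hQ₁).1 h) hQ₂
  refine hb (eq_zero_of_smul_paramMap_add_add hB hzw hzt hwt (a := a) (c := -c) ?_).2.1
  rw [hc, neg_smul, add_neg_cancel]

theorem paramMap_notMem_ker_sup_ker : paramMap B z ∉ Q₁.toLin.ker ⊔ Q₂.toLin.ker := by
  intro hmem
  have ht := hB.paramMap_ne_zero t (right_ne_zero_of_bracket_ne_zero hzt)
  have hne : a • paramMap B z + b • paramMap B w ≠ 0 := fun h =>
    hb (eq_zero_of_smul_paramMap_add_add hB hzw hzt hwt (a := a) (c := 0) (by simpa using h)).2.1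
  obtain ⟨x, hx, y, hy, hxy⟩ := Submodule.mem_sup.1 hmem
  obtain ⟨c, rfl⟩ := Q₁.exists_eq_smul ht hQ₁ hx
  obtain ⟨d, rfl⟩ := Q₂.exists_eq_smul hne hQ₂ hy
  obtain ⟨e₁, e₂, -⟩ := eq_zero_of_smul_paramMap_add_add hB hzw hzt hwt (a := d * a - 1)
    (b := d * b) (c := c) (by
      rw [← sub_eq_zero.2 hxy]
      module)
  rw [(mul_eq_zero.1 e₂).resolve_right hb] at e₁
  norm_num at e₁

theorem distinguishable_of_mem_chord {P₁ P₂ : Camera} {c : Fin 4 → ℂ} (hc0 : c ≠ 0)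
    (hc : P₁.toLin c = 0) {s : ℂ} (hs : s ≠ 0) (hcs : P₂.toLin c = s • Q₂.toLin (paramMap B z)) :
    Distinguishable P₁ P₂ Q₁ Q₂ := by
  refine distinguishable_of_epipole (u := s • paramMap B z) hc0 hc (hcs.trans (map_smul ..).symm)
    (center_ne_of_mem_chord hB hzw hzt hwt hQ₁ hb hQ₂) fun hu => ?_
  exact paramMap_notMem_ker_sup_ker hB hzw hzt hwt hQ₁ hb hQ₂
    ((Submodule.smul_mem_iff _ hs).1 hu)

end Chord

section Node

variable {A : Matrix (Fin 4) (Fin (4 + 1)) ℝ} {B : Matrix (Fin 4) (Fin (3 + 1)) ℝ}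
  {k : Fin (4 + 1) → ℝ} {P P₁ P₂ Q Q₁ Q₂ : Camera} {u v z w : Fin 2 → ℂ} {s t : Fin 2 → ℝ}

theorem bracket_complexify_ne_zero (hu : bracket u (star u) ≠ 0) (ht : t ≠ 0) :
    bracket u (complexify t) ≠ 0 := by
  intro h
  obtain ⟨c, rfl⟩ := exists_eq_smul_of_bracket_eq_zero (complexify_ne_zero.2 ht) h
  refine hu ?_
  rw [star_smul, star_complexify, map_smul, map_smul, LinearMap.smul_apply, bracket_self, smul_zero,
    smul_zero]

theorem IsProjectionFrom.contract_contract_eq_zero_of_node (hA : IsProjectionFrom A k)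
    (hk : OffNormalCurve (complexify k)) (hzw : bracket z w ≠ 0)
    (hPz : P.toLin (paramMap A z) = 0) (hPw : P.toLin (paramMap A w) = 0) :
    contract z (contract w (complexify k)) = 0 :=
  (hA.exists_paramMap_eq_smul_iff hk hzw).1 ((hA.isRationalQuartic_iff.2 hk).exists_paramMap_eq_smul
    (left_ne_zero_of_bracket_ne_zero hzw) (right_ne_zero_of_bracket_ne_zero hzw) hPz hPw)

theorem IsProjectionFrom.center_eq_of_node (hA : IsProjectionFrom A k)
    (hk : OffNormalCurve (complexify k)) (huv : bracket u v ≠ 0)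
    (hu : P₁.toLin (paramMap A u) = 0) (hv : P₁.toLin (paramMap A v) = 0) (hzw : bracket z w ≠ 0)
    (hz : P₂.toLin (paramMap A z) = 0) (hw : P₂.toLin (paramMap A w) = 0) :
    P₁.center = P₂.center := by
  have hu0 := left_ne_zero_of_bracket_ne_zero huv
  refine (Camera.center_eq_iff ((hA.isRationalQuartic_iff.2 hk).2 u hu0) hu).2 ?_
  obtain ⟨α, β, hα, -, hαβ⟩ := hk.exists_eq_veroneseVec_add huv
    (hA.contract_contract_eq_zero_of_node hk huv hu hv)
  have h := hA.contract_contract_eq_zero_of_node hk hzw hz hw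
  simp only [hαβ, map_add, map_smul, contract_veroneseVec, smul_smul] at h
  have hzero {x : Fin 2 → ℂ} (hx : P₂.toLin (paramMap A x) = 0) (hx0 : x ≠ 0)
      (hxu : bracket x u = 0) : P₂.toLin (paramMap A u) = 0 := by
    obtain ⟨c, rfl⟩ := exists_eq_smul_of_bracket_eq_zero hx0 (bracket_swap u x ▸ neg_eq_zero.2 hxu)
    rw [paramMap_smul, map_smul, hx, smul_zero]
  have hzwu := (eq_zero_of_smul_veroneseVec_add (d := 1) huv h).1
  simp only [mul_eq_zero, hα, false_or] at hzwu
  rcases hzwu with h | h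
  · exact hzero hw (right_ne_zero_of_bracket_ne_zero hzw) h
  · exact hzero hz (left_ne_zero_of_bracket_ne_zero hzw) h

/-- The cameras `P`, with center at an isolated real point of the quartic `A` with parameters `u`
and `star u`, and `Q`, with center at the point with parameter `t` of the cubic `B`, map the two
curves to the same conic. -/
structure IsNodeCompanion (A : Matrix (Fin 4) (Fin (4 + 1)) ℝ) (B : Matrix (Fin 4) (Fin (3 + 1)) ℝ)
    (u t : Fin 2 → ℂ) (P Q : Camera) : Prop where
  bracket_ne_zero : bracket u (star u) ≠ 0
  left_center : P.toLin (paramMap A u) = 0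
  right_center : Q.toLin (paramMap B t) = 0
  exists_conic : ∀ z, ∃ (m : Fin 3 → ℂ) (a b : ℂ),
    P.toLin (paramMap A z) = a • m ∧ Q.toLin (paramMap B z) = b • m

namespace IsNodeCompanion

theorem center_eq (h₁ : IsNodeCompanion A B u w P₁ Q₁) (h₂ : IsNodeCompanion A B v z P₂ Q₂)
    (hA : IsProjectionFrom A k) (hk : OffNormalCurve (complexify k)) : P₁.center = P₂.center :=
  hA.center_eq_of_node hk h₁.bracket_ne_zero h₁.left_center
    (Camera.toLin_paramMap_star h₁.left_center) h₂.bracket_ne_zero h₂.left_center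
    (Camera.toLin_paramMap_star h₂.left_center)

theorem center_ne_and_distinguishable (h₁ : IsNodeCompanion A B u (complexify t) P₁ Q₁)
    (h₂ : IsCompanion A B (complexify s) P₂ Q₂) (hA : IsProjectionFrom A k)
    (hk : OffNormalCurve (complexify k)) (hB : IsTwistedCubic B) (ht : t ≠ 0) :
    Q₁.center ≠ Q₂.center ∧ Distinguishable P₁ P₂ Q₁ Q₂ := by
  have hu := h₁.bracket_ne_zero
  have hu' : bracket (star u) (star (star u)) ≠ 0 := by
    rwa [star_star, bracket_ne_zero_comm]
  have hs := complexify_ne_zero.1 h₂.ne_zero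
  obtain ⟨α, β, -, hβ, hαβ⟩ := hk.exists_eq_veroneseVec_add hu
    (hA.contract_contract_eq_zero_of_node hk hu h₁.left_center
      (Camera.toLin_paramMap_star h₁.left_center))
  have hβs := mul_ne_zero hβ (bracket_ne_zero_comm.1 (bracket_complexify_ne_zero hu' hs))
  have hQ₂ : Q₂.toLin ((α * bracket (complexify s) u) • paramMap B u +
      (β * bracket (complexify s) (star u)) • paramMap B (star u)) = 0 := by
    rw [← h₂.toLin_contract hA, hαβ]
    simp only [map_add, map_smul, contract_veroneseVec, smul_smul, coeffLin_veroneseVec]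
  have hut := bracket_complexify_ne_zero hu ht
  have hut' := bracket_complexify_ne_zero hu' ht
  exact ⟨center_ne_of_mem_chord hB hu hut hut' h₁.right_center hβs hQ₂,
    distinguishable_of_mem_chord hB hu hut hut' h₁.right_center hβs hQ₂
      ((hA.isRationalQuartic_iff.2 hk).2 u (left_ne_zero_of_bracket_ne_zero hu)) h₁.left_center
      (bracket_ne_zero_comm.1 (bracket_complexify_ne_zero hu hs)) (h₂.toLin_paramMap u)⟩

end IsNodeCompanion

theorem exists_isNodeCompanion (hA : A.rank = 4) (hB : IsTwistedCubic B)
    (hu : bracket u (star u) ≠ 0) (hPu : P.toLin (paramMap A u) = 0) (ht : t ≠ 0) :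
    ∃ Q, IsNodeCompanion A B u (complexify t) P Q := by
  obtain ⟨N, hN, hP⟩ := exists_conic_of_conj_center hA hu hPu
  obtain ⟨Q, hQ⟩ := exists_camera_of_conic hB ht hN
  exact ⟨Q, hu, hPu, by rw [hQ, bracket_self, zero_smul], fun z => ⟨_, _, _, hP z, hQ z⟩⟩

/-- A camera with center on a quartic has its center at a real parameter or at an isolated real
point; this is the relation to its counterpart on the cubic in either case. -/
def IsRealOrNodeCompanion (A : Matrix (Fin 4) (Fin (4 + 1)) ℝ)
    (B : Matrix (Fin 4) (Fin (3 + 1)) ℝ) (t : Fin 2 → ℝ) (P Q : Camera) : Prop :=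
  (∃ w : Fin 2 → ℝ, IsCompanion A B (complexify w) P Q) ∨
    ∃ u, IsNodeCompanion A B u (complexify t) P Q

theorem exists_isRealOrNodeCompanion (hA : IsRationalQuartic A) (hB : IsTwistedCubic B) (ht : t ≠ 0)
    (hP : P.center ∈ curve A) : ∃ Q, IsRealOrNodeCompanion A B t P Q := by
  rcases Camera.exists_real_or_conj_of_center_mem_curve hP with ⟨w, hw, hPw⟩ | ⟨u, hu, hPu⟩
  · obtain ⟨Q, hQ⟩ := exists_isCompanion_cubic hA hB hw hPw
    exact ⟨Q, Or.inl ⟨w, hQ⟩⟩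
  · obtain ⟨Q, hQ⟩ := exists_isNodeCompanion hA.1 hB hu hPu ht
    exact ⟨Q, Or.inr ⟨u, hQ⟩⟩

namespace IsRealOrNodeCompanion

theorem haveCommonImage (h : IsRealOrNodeCompanion A B t P Q) (hAz : paramMap A z ≠ 0)
    (hBz : paramMap B z ≠ 0) :
    HaveCommonImage P Q (Projectivization.mk ℂ _ hAz) (Projectivization.mk ℂ _ hBz) := by
  rcases h with ⟨w, h⟩ | ⟨u, h⟩
  · exact h.haveCommonImage hAz hBz
  · obtain ⟨m, a, b, hP, hQ⟩ := h.exists_conic z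
    exact haveCommonImage_mk hAz hBz hP hQ

theorem center_ne_and_distinguishable (h₁ : IsRealOrNodeCompanion A B t P₁ Q₁)
    (h₂ : IsRealOrNodeCompanion A B t P₂ Q₂) (hA : IsProjectionFrom A k)
    (hk : OffNormalCurve (complexify k)) (hB : IsTwistedCubic B) (ht : t ≠ 0)
    (hP : P₁.center ≠ P₂.center) : Q₁.center ≠ Q₂.center ∧ Distinguishable P₁ P₂ Q₁ Q₂ := by
  rcases h₁ with ⟨w₁, h₁⟩ | ⟨u₁, h₁⟩ <;> rcases h₂ with ⟨w₂, h₂⟩ | ⟨u₂, h₂⟩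
  · exact ⟨h₁.center_ne h₂ hA hk hP hB, h₁.distinguishable h₂ hA hk hP hB⟩
  · exact (h₂.center_ne_and_distinguishable h₁ hA hk hB ht).imp Ne.symm Distinguishable.swap
  · exact h₁.center_ne_and_distinguishable h₂ hA hk hB ht
  · exact absurd (h₁.center_eq h₂ hA hk) hP

end IsRealOrNodeCompanion

theorem IsRationalQuartic.isNonTriviallyCritical {n : ℕ} (hn : 2 ≤ n) (hA : IsRationalQuartic A)
    {P : CameraTuple n} (hP : P.CentersIn (curve A)) {X : Set P3} (hX : X ⊆ curve A) :
    IsNonTriviallyCritical P X := by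
  obtain ⟨k, hAk⟩ := exists_isProjectionFrom_of_rank_eq hA.1
  have hk := hAk.isRationalQuartic_iff.1 hA
  have hB := isTwistedCubic_one
  have ht : (![1, 0] : Fin 2 → ℝ) ≠ 0 := by simp
  choose Q hQ using fun i => exists_isRealOrNodeCompanion hA hB ht (hP i)
  have hQQ (i j) (hij : i ≠ j) :=
    (hQ i).center_ne_and_distinguishable (hQ j) hAk hk hB ht (P.distinct.ne hij)
  have h : ConjugateAlong P (curve A) ⟨Q, fun i j => not_imp_not.1 fun hij => (hQQ i j hij).1⟩
      (curve (1 : Matrix (Fin 4) (Fin (3 + 1)) ℝ)) := by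
    rw [curve_eq_range hA.2, curve_eq_range hB.paramMap_ne_zero]
    exact conjugateAlong_range hn (fun i z => (hQ i).haveCommonImage _ _) fun i j hij =>
      (hQQ i j hij).2
  exact h.isNonTriviallyCritical hX

end Node

/-! ### Lines as contraction lines -/

section Line

variable {n : ℕ} {Q : CameraTuple n} {L : Submodule ℂ (Fin 4 → ℂ)}

theorem CameraTuple.star_mem_of_centersIn (hn : 2 ≤ n) (hL : IsLine L)
    (hQ : Q.CentersIn (linePoints L)) {v : Fin 4 → ℂ} (hv : v ∈ L) : star v ∈ L := by
  let i : Fin n := ⟨0, by omega⟩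
  let j : Fin n := ⟨1, by omega⟩
  have hij : i ≠ j := by simp [i, j]
  obtain ⟨r, hr, hQr⟩ := (Q.cam i).exists_real_ker
  obtain ⟨s, hs, hQs⟩ := (Q.cam j).exists_real_ker
  have hr0 := complexify_ne_zero.2 hr
  have hrL := Camera.center_mem_linePoints_iff.1 (hQ i) hQr
  have hsL := Camera.center_mem_linePoints_iff.1 (hQ j) hQs
  have hrs : LinearIndependent ℂ ![complexify r, complexify s] := by
    rw [LinearIndependent.pair_iff' hr0]
    rintro a ha
    have ha0 : a ≠ 0 := by
      rintro rfl
      exact complexify_ne_zero.2 hs (ha.symm.trans (zero_smul ..))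
    rw [← ha, map_smul, smul_eq_zero, or_iff_right ha0] at hQs
    exact Q.distinct.ne hij ((Camera.center_eq_iff hr0 hQr).2 hQs)
  have hspan : Submodule.span ℂ {complexify r, complexify s} = L := by
    refine Submodule.eq_of_le_of_finrank_eq (Submodule.span_le.2 ?_) ?_
    · simp [Set.insert_subset_iff, hrL, hsL]
    · rw [← Matrix.range_cons_cons_empty, finrank_span_eq_card hrs, hL, Fintype.card_fin]
  obtain ⟨a, b, rfl⟩ := Submodule.mem_span_pair.1 (hspan.symm ▸ hv)
  rw [star_add, star_smul, star_smul, star_complexify, star_complexify]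
  exact L.add_mem (L.smul_mem _ hrL) (L.smul_mem _ hsL)

end Line

section Prolongation

variable {K : Type*} [Field K] {d : ℕ}

/-- The dual binary forms of degree `d + 1` all of whose contractions with linear forms lie in
`W`. -/
def prolongation (W : Submodule K (Fin (d + 1) → K)) : Submodule K (Fin (d + 2) → K) :=
  ⨅ x, W.comap (contract x)

theorem mem_prolongation {W : Submodule K (Fin (d + 1) → K)} {k : Fin (d + 2) → K} :
    k ∈ prolongation W ↔ ∀ x, contract x k ∈ W := by
  simp only [prolongation, Submodule.mem_iInf, Submodule.mem_comap]

theorem prolongation_ne_bot {W : Submodule K (Fin (d + 1) → K)}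
    (hW : d < 2 * Module.finrank K W) : prolongation W ≠ ⊥ := by
  let φ := (W.mkQ ∘ₗ contract ![1, 0]).prod (W.mkQ ∘ₗ contract ![0, 1])
  have hφ : φ.ker ≠ ⊥ := by
    apply LinearMap.ker_ne_bot_of_finrank_lt
    have hquot := W.finrank_quotient_add_finrank
    rw [Module.finrank_fin_fun] at hquot
    rw [Module.finrank_prod, Module.finrank_fin_fun]
    omega
  refine ne_bot_of_le_ne_bot hφ fun k hk => mem_prolongation.2 fun x => ?_
  have h : contract ![1, 0] k ∈ W ∧ contract ![0, 1] k ∈ W := by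
    simpa [φ, LinearMap.mem_ker] using hk
  have hx : x = x 0 • ![1, 0] + x 1 • ![0, 1] := by
    ext i
    fin_cases i <;> simp
  rw [hx, map_add, map_smul, map_smul]
  exact W.add_mem (W.smul_mem _ h.1) (W.smul_mem _ h.2)

theorem eq_zero_of_forall_contract_eq_zero {v : Fin (d + 2) → K} (h : ∀ x, contract x v = 0) :
    v = 0 := by
  have hx : (![1, 0] : Fin 2 → K) ≠ 0 := by simp
  obtain ⟨a, rfl⟩ := exists_eq_smul_veroneseVec hx (h _)
  obtain ⟨w, hw⟩ := exists_bracket_ne_zero hx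
  have hwa := h w
  rw [map_smul, contract_veroneseVec, smul_smul, smul_eq_zero,
    or_iff_left (veroneseVec_ne_zero hx), mul_eq_zero,
    or_iff_left (bracket_ne_zero_comm.1 hw)] at hwa
  rw [hwa, zero_smul]

theorem prolongation_ker_contract_contract (z w : Fin 2 → K) :
    prolongation (contract z ∘ₗ contract (d := d + 1) w).ker =
      (contract z ∘ₗ contract (d := d + 2) w).ker := by
  ext k
  simp only [mem_prolongation, LinearMap.mem_ker, LinearMap.comp_apply]
  have hcomm (x) :
      contract z (contract w (contract x k)) = contract x (contract z (contract w k)) := by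
    rw [contract_comm w, contract_comm z]
  refine ⟨fun h => eq_zero_of_forall_contract_eq_zero fun x => (hcomm x).symm.trans (h x),
    fun h x => ?_⟩
  rw [hcomm, h, map_zero]

theorem finrank_ker_contract_contract {z w : Fin 2 → K} (hz : z ≠ 0) (hw : w ≠ 0) :
    Module.finrank K (contract z ∘ₗ contract (d := d + 1) w).ker = 2 := by
  have hsurj : Function.Surjective (contract z ∘ₗ contract (d := d + 1) w) :=
    (contract_surjective hz).comp (contract_surjective hw)
  have h := (contract z ∘ₗ contract (d := d + 1) w).finrank_range_add_finrank_ker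
  rw [LinearMap.range_eq_top.2 hsurj, finrank_top, Module.finrank_fin_fun,
    Module.finrank_fin_fun] at h
  omega

theorem star_mem_prolongation {W : Submodule ℂ (Fin (d + 1) → ℂ)} (hW : ∀ v ∈ W, star v ∈ W)
    {k : Fin (d + 2) → ℂ} (hk : k ∈ prolongation W) : star k ∈ prolongation W :=
  mem_prolongation.2 fun x => by
    rw [← star_star x, ← star_contract]
    exact hW _ (mem_prolongation.1 hk _)

end Prolongation

section Vertex

variable {B : Matrix (Fin 4) (Fin (3 + 1)) ℝ} {L : Submodule ℂ (Fin 4 → ℂ)}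

theorem exists_eq_smul_veroneseVec_of_not_offNormalCurve {d : ℕ} {k : Fin (d + 2) → ℂ}
    (hk : ¬OffNormalCurve k) :
    ∃ (z : Fin 2 → ℂ) (a : ℂ), z ≠ 0 ∧ k = a • veroneseVec (d + 1) z := by
  simp only [OffNormalCurve, not_forall] at hk
  obtain ⟨z, hzk, hz⟩ := hk
  obtain ⟨a, ha⟩ := exists_eq_smul_veroneseVec hz hzk
  exact ⟨z, a, hz, ha⟩

theorem offNormalCurve_or_of_notMem_span {d : ℕ} {k l : Fin (d + 3) → ℂ} (hk : k ≠ 0)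
    (hl : l ∉ Submodule.span ℂ {k}) :
    OffNormalCurve k ∨ OffNormalCurve l ∨ OffNormalCurve (k + l) := by
  by_contra! ⟨hk', hl', hkl⟩
  obtain ⟨x, a, hx, rfl⟩ := exists_eq_smul_veroneseVec_of_not_offNormalCurve hk'
  obtain ⟨y, b, hy, rfl⟩ := exists_eq_smul_veroneseVec_of_not_offNormalCurve hl'
  have ha : a ≠ 0 := left_ne_zero_of_smul hk
  have hxy : bracket x y ≠ 0 := by
    intro hxy
    obtain ⟨c, rfl⟩ := exists_eq_smul_of_bracket_eq_zero hx (by rw [bracket_swap, hxy, neg_zero])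
    refine hl (Submodule.mem_span_singleton.2 ⟨b * c ^ (d + 2) / a, ?_⟩)
    rw [veroneseVec_smul, smul_smul, smul_smul, div_mul_cancel₀ _ ha]
  have hb : b ≠ 0 := by
    rintro rfl
    exact hl (by simp)
  simp only [OffNormalCurve, not_forall] at hkl
  obtain ⟨z, hz, hz0⟩ := hkl
  rw [map_add, map_smul, map_smul, contract_veroneseVec, contract_veroneseVec, smul_smul,
    smul_smul] at hz
  obtain ⟨hzx, hzy⟩ := eq_zero_of_smul_veroneseVec_add hxy hz
  obtain ⟨c, rfl⟩ :=
    exists_eq_smul_of_bracket_eq_zero hx ((mul_eq_zero.1 hzx).resolve_left ha)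
  have hc : c = 0 := by simpa [hb, hxy] using hzy
  exact hz0 (by rw [hc, zero_smul])

theorem exists_offNormalCurve_complexify_mem {d : ℕ} {V : Submodule ℂ (Fin (d + 3) → ℂ)}
    (hV : ∀ v ∈ V, star v ∈ V) (hV2 : 2 ≤ Module.finrank ℂ V) :
    ∃ k, complexify k ∈ V ∧ OffNormalCurve (complexify k) := by
  obtain ⟨k, hk, hk0⟩ := exists_complexify_mem_notMem hV (W := ⊥) fun h => by
    rw [le_bot_iff.1 h, finrank_bot] at hV2
    omega
  obtain ⟨l, hl, hl0⟩ :=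
    exists_complexify_mem_notMem hV (W := Submodule.span ℂ {complexify k}) fun h => by
      have hle := (Submodule.finrank_mono h).trans (finrank_span_singleton hk0).le
      omega
  rcases offNormalCurve_or_of_notMem_span hk0 hl0 with h | h | h
  · exact ⟨k, hk, h⟩
  · exact ⟨l, hl, h⟩
  · exact ⟨k + l, by rw [map_add]; exact V.add_mem hk hl, by rwa [map_add]⟩

section Contraction

theorem star_mem_comap_coeffLin (hL : ∀ v ∈ L, star v ∈ L) :
    ∀ v ∈ L.comap (coeffLin B), star v ∈ L.comap (coeffLin B) := fun v hv => by
  rw [Submodule.mem_comap, ← star_coeffLin]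
  exact hL _ hv

variable (hB : IsTwistedCubic B) (hL : IsLine L)
include hB hL

theorem contractionLine_eq_of_mem_prolongation {k : Fin (4 + 1) → ℂ} (hk : OffNormalCurve k)
    (hkL : k ∈ prolongation (L.comap (coeffLin B))) : contractionLine B k = L := by
  refine Submodule.eq_of_le_of_finrank_eq ?_ ((finrank_contractionLine hB hk).trans hL.symm)
  rintro _ ⟨x, rfl⟩
  exact mem_prolongation.1 hkL x

theorem finrank_comap_coeffLin : Module.finrank ℂ (L.comap (coeffLin B)) = 2 :=
  ((LinearEquiv.ofInjectiveEndo (coeffLin B) hB.coeffLin_injective).ofSubmodule' L).finrank_eq.trans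
    hL

variable (hstar : ∀ v ∈ L, star v ∈ L)
include hstar

theorem exists_contractionLine_eq_of_disjoint (hdisj : Disjoint (linePoints L) (curve B)) :
    ∃ k, OffNormalCurve (complexify k) ∧ contractionLine B (complexify k) = L := by
  have hbot : prolongation (L.comap (coeffLin B)) ≠ ⊥ :=
    prolongation_ne_bot (by rw [finrank_comap_coeffLin hB hL]; norm_num)
  obtain ⟨k, hk, hk0⟩ := exists_complexify_mem_notMem (W := ⊥)
    (fun v => star_mem_prolongation (star_mem_comap_coeffLin hstar))
    (mt le_bot_iff.1 hbot)
  have hk' : OffNormalCurve (complexify k) := by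
    by_contra hoff
    obtain ⟨z, a, hz, ha⟩ := exists_eq_smul_veroneseVec_of_not_offNormalCurve hoff
    obtain ⟨w, hw⟩ := exists_bracket_ne_zero hz
    have hmem := mem_prolongation.1 hk w
    rw [ha, map_smul, contract_veroneseVec, smul_smul, Submodule.smul_mem_iff _ ?_] at hmem
    · have hz' := hB.paramMap_ne_zero z hz
      exact Set.disjoint_right.1 hdisj ⟨z, hz, hz', rfl⟩ ((mk_mem_linePoints hz').2 hmem)
    · refine mul_ne_zero ?_ (bracket_ne_zero_comm.1 hw)
      rintro rfl
      exact hk0 (ha.trans (zero_smul ..))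
  exact ⟨k, hk', contractionLine_eq_of_mem_prolongation hB hL hk' hk⟩

omit hL in
theorem exists_contractionLine_eq_of_isSecantLine (hL : IsSecantLine B L) :
    ∃ k, OffNormalCurve (complexify k) ∧ contractionLine B (complexify k) = L ∧
      OnSecantVariety (complexify k) := by
  obtain ⟨z, w, hz, hw, h⟩ := hL.exists_contract_contract_eq_zero hB
  have hW : L.comap (coeffLin B) = (contract z ∘ₗ contract w).ker :=
    Submodule.eq_of_le_of_finrank_eq h
      ((finrank_comap_coeffLin hB hL.1).trans (finrank_ker_contract_contract hz hw).symm)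
  have hV : prolongation (L.comap (coeffLin B)) = (contract z ∘ₗ contract w).ker :=
    hW ▸ prolongation_ker_contract_contract z w
  obtain ⟨k, hk, hk'⟩ := exists_offNormalCurve_complexify_mem
    (fun v => star_mem_prolongation (star_mem_comap_coeffLin hstar))
    (hV ▸ finrank_ker_contract_contract hz hw).ge
  exact ⟨k, hk', contractionLine_eq_of_mem_prolongation hB hL.1 hk' hk, z, w, hz, hw, hV.le hk⟩

end Contraction

end Vertex

/-! ### Cameras on a line -/

section LineCameras

variable {n : ℕ} {A : Matrix (Fin 4) (Fin (4 + 1)) ℝ} {B : Matrix (Fin 4) (Fin (3 + 1)) ℝ}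
  {k : Fin (4 + 1) → ℝ} {L : Submodule ℂ (Fin 4 → ℂ)}

theorem exists_isProjectionFrom_of_ne_zero (hk : k ≠ 0) : ∃ A, IsProjectionFrom A k := by
  have hfin : Module.finrank ℝ ((Fin (4 + 1) → ℝ) ⧸ Submodule.span ℝ {k}) =
      Module.finrank ℝ (Fin 4 → ℝ) := by
    have h := (Submodule.span ℝ {k}).finrank_quotient_add_finrank
    rw [finrank_span_singleton hk, Module.finrank_fin_fun] at h
    rw [Module.finrank_fin_fun]
    omega
  let e := LinearEquiv.ofFinrankEq _ _ hfin
  let f := e.toLinearMap ∘ₗ (Submodule.span ℝ {k}).mkQ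
  have hf (v) : LinearMap.toMatrix' f *ᵥ v = f v := LinearMap.toMatrix'_mulVec f v
  have hsurj : Function.Surjective (LinearMap.toMatrix' f).mulVec := by
    rw [funext hf]
    exact e.surjective.comp (Submodule.mkQ_surjective _)
  refine ⟨LinearMap.toMatrix' f, ?_, hk, ?_⟩
  · simpa using rank_eq_card_iff_surjective.2 hsurj
  · rw [hf, LinearMap.comp_apply, Submodule.mkQ_apply,
      (Submodule.Quotient.mk_eq_zero _).2 (Submodule.mem_span_singleton_self k), map_zero]

theorem Camera.exists_real_contract_of_center_mem (hB : IsTwistedCubic B)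
    (hk : OffNormalCurve (complexify k)) {Q : Camera}
    (hQ : Q.center ∈ linePoints (contractionLine B (complexify k))) :
    ∃ w : Fin 2 → ℝ, w ≠ 0 ∧
      Q.toLin (coeffLin B (contract (complexify w) (complexify k))) = 0 := by
  obtain ⟨p, hp, hQp⟩ := Q.exists_real_ker
  obtain ⟨x, hx⟩ := mem_contractionLine.1 (Camera.center_mem_linePoints_iff.1 hQ hQp)
  have hstar : contract (star x) (complexify k) = contract x (complexify k) := by
    apply hB.coeffLin_injective
    rw [hx, ← star_complexify p, ← hx, star_coeffLin, star_contract, star_complexify]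
  obtain ⟨w, rfl⟩ := exists_complexify_eq_of_star_eq (v := x) (sub_eq_zero.1 (hk _ (by
    rw [map_sub, LinearMap.sub_apply, hstar, sub_self])))
  refine ⟨w, ?_, by rw [hx, hQp]⟩
  rintro rfl
  rw [map_zero, map_zero, LinearMap.zero_apply, map_zero] at hx
  exact complexify_ne_zero.2 hp hx.symm

namespace IsCompanion

variable {P₁ P₂ Q₁ Q₂ : Camera} {w₁ w₂ : Fin 2 → ℂ} (h₁ : IsCompanion A B w₁ P₁ Q₁)
  (h₂ : IsCompanion A B w₂ P₂ Q₂) (hA : IsProjectionFrom A k) (hk : OffNormalCurve (complexify k))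
  (hB : IsTwistedCubic B)
include h₁ h₂ hA hk hB

theorem bracket_ne_zero_of_center_ne (hQ : Q₁.center ≠ Q₂.center) : bracket w₁ w₂ ≠ 0 := by
  intro h
  obtain ⟨c, rfl⟩ := exists_eq_smul_of_bracket_eq_zero h₂.ne_zero h
  have hne : coeffLin B (contract (c • w₂) (complexify k)) ≠ 0 := fun h0 =>
    h₁.ne_zero (hk _ (hB.coeffLin_injective (h0.trans (map_zero _).symm)))
  refine hQ ((Camera.center_eq_iff hne (h₁.toLin_contract hA)).2 ?_)
  rw [map_smul, LinearMap.smul_apply, map_smul, map_smul, h₂.toLin_contract hA, smul_zero]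

theorem center_mem_curve_of_center_eq (hP : P₁.center = P₂.center) (hw : bracket w₁ w₂ ≠ 0) :
    Q₂.center ∈ curve B := by
  have hP₂ : P₂.toLin (paramMap A w₁) = 0 := (Camera.center_eq_iff
    ((hA.isRationalQuartic_iff.2 hk).2 _ h₁.ne_zero) h₁.toLin_paramMap_self).1 hP
  obtain ⟨a, ha0, ha⟩ := hk.exists_contract_eq h₁.ne_zero h₂.ne_zero
    (hA.contract_contract_eq_zero_of_node hk hw hP₂ h₂.toLin_paramMap_self)
  have hQ₂ := h₂.toLin_contract hA
  rw [ha, map_smul, map_smul, coeffLin_veroneseVec, smul_eq_zero, or_iff_right ha0] at hQ₂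
  have hne := hB.paramMap_ne_zero w₁ h₁.ne_zero
  exact ⟨w₁, h₁.ne_zero, hne, (Q₂.center_eq_mk_iff hne).2 hQ₂⟩

end IsCompanion

theorem exists_isCompanion_quarticTuple (hA : IsProjectionFrom A k)
    (hk : OffNormalCurve (complexify k)) (hB : IsTwistedCubic B) {Q : CameraTuple n}
    (hQ : Q.CentersIn (linePoints (contractionLine B (complexify k))))
    (hone : Q.AtMostOneCenterIn (curve B)) :
    ∃ (P : CameraTuple n) (w : Fin n → Fin 2 → ℝ),
      ∀ i, IsCompanion A B (complexify (w i)) (P.cam i) (Q.cam i) := by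
  choose w hw hQw using fun i => Camera.exists_real_contract_of_center_mem hB hk (hQ i)
  choose P hP using fun i => exists_isCompanion_quartic hA hB (hw i) (hQw i)
  refine ⟨⟨P, fun i j hij => ?_⟩, w, hP⟩
  by_contra hne
  have hbr := (hP i).bracket_ne_zero_of_center_ne (hP j) hA hk hB (Q.distinct.ne hne)
  exact hne (hone i j
    ((hP j).center_mem_curve_of_center_eq (hP i) hA hk hB hij.symm (bracket_ne_zero_comm.1 hbr))
    ((hP i).center_mem_curve_of_center_eq (hP j) hA hk hB hij hbr))

theorem IsCompanion.center_mem_realBranch {P Q : Camera} {w : Fin 2 → ℝ} (hA : IsRationalQuartic A)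
    (h : IsCompanion A B (complexify w) P Q) : P.center ∈ realBranch A :=
  have hne := hA.2 _ h.ne_zero
  ⟨w, complexify_ne_zero.1 h.ne_zero, hne, (P.center_eq_mk_iff hne).2 h.toLin_paramMap_self⟩

theorem realBranch_subset_curve {d : ℕ} (A : Matrix (Fin 4) (Fin (d + 1)) ℝ) :
    realBranch A ⊆ curve A :=
  fun _ ⟨w, hw, hw', h⟩ => ⟨complexify w, complexify_ne_zero.2 hw, hw', h⟩

theorem exists_conjugateAlong_of_contractionLine (hn : 2 ≤ n) (hB : IsTwistedCubic B)
    (hk : OffNormalCurve (complexify k)) {Q : CameraTuple n}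
    (hQ : Q.CentersIn (linePoints (contractionLine B (complexify k))))
    (hone : Q.AtMostOneCenterIn (curve B)) :
    ∃ (A : Matrix (Fin 4) (Fin (4 + 1)) ℝ) (P : CameraTuple n), IsProjectionFrom A k ∧
      P.CentersIn (realBranch A) ∧ ConjugateAlong Q (curve B) P (curve A) := by
  have hk0 : k ≠ 0 := by
    rintro rfl
    have h1 : (fun _ => 1 : Fin 2 → ℂ) = 0 := hk _ (by rw [map_zero, map_zero])
    exact one_ne_zero (congrFun h1 0)
  obtain ⟨A, hA⟩ := exists_isProjectionFrom_of_ne_zero hk0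
  obtain ⟨P, w, hP⟩ := exists_isCompanion_quarticTuple hA hk hB hQ hone
  exact ⟨A, P, hA, fun i => (hP i).center_mem_realBranch (hA.isRationalQuartic_iff.2 hk),
    (conjugateAlong_of_isCompanion hP hA hk hB hn).2⟩

theorem disjointLine_conjugateAlong (hn : 2 ≤ n) (hB : IsTwistedCubic B) (hL : IsLine L)
    (hdisj : Disjoint (linePoints L) (curve B)) {Q : CameraTuple n}
    (hQ : Q.CentersIn (linePoints L)) :
    ∃ (A : Matrix (Fin 4) (Fin (4 + 1)) ℝ) (P : CameraTuple n), IsSmoothRationalQuartic A ∧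
      P.CentersIn (curve A) ∧ ConjugateAlong Q (curve B) P (curve A) := by
  obtain ⟨k, hk, rfl⟩ := exists_contractionLine_eq_of_disjoint hB hL
    (fun _ => CameraTuple.star_mem_of_centersIn hn hL hQ) hdisj
  obtain ⟨A, P, hA, hP, h⟩ := exists_conjugateAlong_of_contractionLine hn hB hk hQ fun i _ hi _ =>
    absurd hi (Set.disjoint_left.1 hdisj (hQ i))
  exact ⟨A, P, ⟨hA.isRationalQuartic_iff.2 hk, (hA.isEmbeddedCurve_iff hk).2
    ((disjoint_contractionLine_iff hB hk).1 hdisj)⟩, fun i => realBranch_subset_curve A (hP i), h⟩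

theorem secantLine_conjugateAlong (hn : 2 ≤ n) (hB : IsTwistedCubic B) (hL : IsSecantLine B L)
    {Q : CameraTuple n} (hQ : Q.CentersIn (linePoints L))
    (hone : Q.AtMostOneCenterIn (curve B)) :
    ∃ (A : Matrix (Fin 4) (Fin (4 + 1)) ℝ) (P : CameraTuple n), IsSingularRationalQuartic A ∧
      P.CentersIn (realBranch A) ∧ ConjugateAlong Q (curve B) P (curve A) := by
  obtain ⟨k, hk, rfl, hsec⟩ := exists_contractionLine_eq_of_isSecantLine hB
    (fun _ => CameraTuple.star_mem_of_centersIn hn hL.1 hQ) hL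
  obtain ⟨A, P, hA, hP, h⟩ := exists_conjugateAlong_of_contractionLine hn hB hk hQ hone
  exact
    ⟨A, P, ⟨hA.isRationalQuartic_iff.2 hk, fun h => (hA.isEmbeddedCurve_iff hk).1 h hsec⟩, hP, h⟩

end LineCameras

/-! ### Moving two camera centers along a twisted cubic -/

section MovedCenters

variable {n : ℕ} {B : Matrix (Fin 4) (Fin (3 + 1)) ℝ} {L : Submodule ℂ (Fin 4 → ℂ)}
  {P Q : Camera} {u v s t : Fin 2 → ℂ}

theorem IsTwistedCubic.exists_real_of_center_mem (hB : IsTwistedCubic B)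
    (hQ : Q.center ∈ curve B) :
    ∃ w : Fin 2 → ℝ, w ≠ 0 ∧ Q.toLin (paramMap B (complexify w)) = 0 := by
  refine (Camera.exists_real_or_conj_of_center_mem_curve hQ).resolve_right ?_
  rintro ⟨u, hu, hQu⟩
  obtain ⟨c, hc⟩ := Q.exists_eq_smul (hB.paramMap_ne_zero u (left_ne_zero_of_bracket_ne_zero hu))
    hQu (Camera.toLin_paramMap_star hQu)
  have h : c • veroneseVec 3 u + (-1 : ℂ) • veroneseVec 3 (star u) = 0 :=
    hB.coeffLin_injective <| by
      rw [map_add, map_smul, map_smul, coeffLin_veroneseVec, coeffLin_veroneseVec, hc, neg_one_smul,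
        add_neg_cancel, map_zero]
  exact neg_ne_zero.2 one_ne_zero (eq_zero_of_smul_veroneseVec_add (d := 2) hu h).2

theorem IsTwistedCubic.exists_ker_mem_chord (hB : IsTwistedCubic B) (hL : IsLine L)
    (huv : bracket u v ≠ 0) (hu : paramMap B u ∈ L) (hv : paramMap B v ∈ L)
    (hQ : Q.center ∈ linePoints L) (hQu : Q.toLin (paramMap B u) ≠ 0) :
    ∃ a b : ℂ, b ≠ 0 ∧ Q.toLin (a • paramMap B u + b • paramMap B v) = 0 := by
  have hind : LinearIndependent ℂ ![paramMap B u, paramMap B v] :=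
    LinearIndependent.pair_iff.2 fun a b h =>
      eq_zero_of_smul_veroneseVec_add (d := 2) huv <| hB.coeffLin_injective <| by
        simpa only [map_add, map_smul, coeffLin_veroneseVec, map_zero] using h
  have hspan : Submodule.span ℂ {paramMap B u, paramMap B v} = L := by
    refine Submodule.eq_of_le_of_finrank_eq (Submodule.span_le.2 (Set.pair_subset hu hv)) ?_
    rw [← Matrix.range_cons_cons_empty _ _ ![], finrank_span_eq_card hind, hL, Fintype.card_fin]
  obtain ⟨p, hp0, hp⟩ := Q.exists_real_ker
  have hpL := Camera.center_mem_linePoints_iff.1 hQ hp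
  obtain ⟨a, b, hab⟩ := Submodule.mem_span_pair.1 (hspan ▸ hpL)
  refine ⟨a, b, ?_, by rw [hab, hp]⟩
  rintro rfl
  rw [zero_smul, add_zero] at hab
  rw [← hab, map_smul, smul_eq_zero, or_iff_left hQu] at hp
  rw [hp, zero_smul] at hab
  exact complexify_ne_zero.2 hp0 hab.symm

/-- The cameras `Q` and `P`, with centers at the points with parameters `u` and `t` of the cubic
`B`, map it to the same conic. -/
def IsReprojection (B : Matrix (Fin 4) (Fin (3 + 1)) ℝ) (u t : Fin 2 → ℂ) (Q P : Camera) : Prop :=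
  ∀ z, ∃ m, Q.toLin (paramMap B z) = bracket u z • m ∧ P.toLin (paramMap B z) = bracket t z • m

theorem exists_isReprojection (hB : IsTwistedCubic B) {u t : Fin 2 → ℝ} (hu : u ≠ 0)
    (hQ : Q.toLin (paramMap B (complexify u)) = 0) (ht : t ≠ 0) :
    ∃ P, IsReprojection B (complexify u) (complexify t) Q P := by
  obtain ⟨N, hN, hQN⟩ := exists_conic_of_real_center hB hu hQ
  obtain ⟨P, hPN⟩ := exists_camera_of_conic hB ht hN
  exact ⟨P, fun z => ⟨_, hQN z, hPN z⟩⟩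

namespace IsReprojection

theorem toLin_left (h : IsReprojection B u t Q P) : Q.toLin (paramMap B u) = 0 := by
  obtain ⟨m, hm, -⟩ := h u
  rw [hm, bracket_self, zero_smul]

theorem toLin_right (h : IsReprojection B u t Q P) : P.toLin (paramMap B t) = 0 := by
  obtain ⟨m, -, hm⟩ := h t
  rw [hm, bracket_self, zero_smul]

theorem haveCommonImage (h : IsReprojection B u t Q P) {z : Fin 2 → ℂ} (hz : paramMap B z ≠ 0) :
    HaveCommonImage Q P (Projectivization.mk ℂ _ hz) (Projectivization.mk ℂ _ hz) := by
  obtain ⟨m, hQ, hP⟩ := h z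
  exact haveCommonImage_mk hz hz hQ hP

variable {P₁ P₂ Q₁ Q₂ : Camera}

theorem center_ne_and_distinguishable (h₁ : IsReprojection B u t Q₁ P₁)
    (h₂ : IsReprojection B v s Q₂ P₂) (hB : IsTwistedCubic B) (huv : bracket u v ≠ 0)
    (hus : bracket u s ≠ 0) (hut : bracket u t ≠ 0) (hst : bracket s t ≠ 0) :
    P₁.center ≠ P₂.center ∧ Distinguishable Q₁ Q₂ P₁ P₂ := by
  have hP₂ : P₂.toLin ((0 : ℂ) • paramMap B u + (1 : ℂ) • paramMap B s) = 0 := by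
    rw [zero_smul, zero_add, one_smul, h₂.toLin_right]
  have hsu := bracket_ne_zero_comm.1 hus
  obtain ⟨m, hQm, hPm⟩ := h₂ u
  refine ⟨center_ne_of_mem_chord hB hus hut hst h₁.toLin_right one_ne_zero hP₂,
    distinguishable_of_mem_chord hB hus hut hst h₁.toLin_right one_ne_zero hP₂
      (hB.paramMap_ne_zero u (left_ne_zero_of_bracket_ne_zero huv)) h₁.toLin_left
      (div_ne_zero (bracket_ne_zero_comm.1 huv) hsu) ?_⟩
  rw [hQm, hPm, smul_smul, div_mul_cancel₀ _ hsu]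

theorem center_ne_and_distinguishable_of_fixed (h : IsReprojection B u t Q₁ P₁)
    (hB : IsTwistedCubic B) (hL : IsLine L) (huv : bracket u v ≠ 0) (hut : bracket u t ≠ 0)
    (hvt : bracket v t ≠ 0) (hQ₁ : Q₁.center ∈ linePoints L) (hv : paramMap B v ∈ L)
    (hQ : Q.center ∈ linePoints L) (hne : Q₁.center ≠ Q.center) :
    P₁.center ≠ Q.center ∧ Distinguishable Q₁ Q P₁ Q := by
  have hu0 := hB.paramMap_ne_zero u (left_ne_zero_of_bracket_ne_zero huv)
  obtain ⟨a, b, hb, hab⟩ := hB.exists_ker_mem_chord hL huv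
    (Camera.center_mem_linePoints_iff.1 hQ₁ h.toLin_left) hv hQ
    fun hQu => hne ((Camera.center_eq_iff hu0 h.toLin_left).2 hQu)
  exact ⟨center_ne_of_mem_chord hB huv hut hvt h.toLin_right hb hab,
    distinguishable_of_mem_chord hB huv hut hvt h.toLin_right hb hab hu0 h.toLin_left one_ne_zero
      (one_smul ..).symm⟩

end IsReprojection

/-- The cameras `P` arise from `Q` by moving the centers of the cameras `i` and `j` along the cubic
`B`, from the parameters `u` and `v` to `t` and `s`, in such a way that the image of the cubic under
each camera remains the same. -/
structure MovesTwoCenters (B : Matrix (Fin 4) (Fin (3 + 1)) ℝ) (Q P : Fin n → Camera) (i j : Fin n)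
    (u v t s : Fin 2 → ℂ) : Prop where
  source : bracket u v ≠ 0
  target : bracket t s ≠ 0
  left_left : bracket u t ≠ 0
  left_right : bracket u s ≠ 0
  right_left : bracket v t ≠ 0
  right_right : bracket v s ≠ 0
  left : IsReprojection B u t (Q i) (P i)
  right : IsReprojection B v s (Q j) (P j)
  fixed : ∀ l, l ≠ i → l ≠ j → P l = Q l

namespace MovesTwoCenters

variable {Q : CameraTuple n} {P : Fin n → Camera} {i j : Fin n}

theorem symm (h : MovesTwoCenters B Q.cam P i j u v t s) :
    MovesTwoCenters B Q.cam P j i v u s t where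
  source := bracket_ne_zero_comm.1 h.source
  target := bracket_ne_zero_comm.1 h.target
  left_left := h.right_right
  left_right := h.right_left
  right_left := h.left_right
  right_right := h.left_left
  left := h.right
  right := h.left
  fixed l hj hi := h.fixed l hi hj

theorem haveCommonImage (h : MovesTwoCenters B Q.cam P i j u v t s) {z : Fin 2 → ℂ}
    (hz : paramMap B z ≠ 0) (l : Fin n) :
    HaveCommonImage (Q.cam l) (P l) (Projectivization.mk ℂ _ hz) (Projectivization.mk ℂ _ hz) := by
  rcases eq_or_ne l i with rfl | hi
  · exact h.left.haveCommonImage hz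
  rcases eq_or_ne l j with rfl | hj
  · exact h.right.haveCommonImage hz
  rw [h.fixed l hi hj]
  exact haveCommonImage_mk hz hz (one_smul ..).symm (one_smul ..).symm

variable (hB : IsTwistedCubic B) (hL : IsLine L) (hQ : Q.CentersIn (linePoints L)) {a b : Fin n}
include hB hL hQ

theorem center_ne_and_distinguishable_left (h : MovesTwoCenters B Q.cam P i j u v t s)
    (hb : b ≠ i) :
    (P i).center ≠ (P b).center ∧ Distinguishable (Q.cam i) (Q.cam b) (P i) (P b) := by
  rcases eq_or_ne b j with rfl | hj
  · exact h.left.center_ne_and_distinguishable h.right hB h.source h.left_right h.left_left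
      (bracket_ne_zero_comm.1 h.target)
  · rw [h.fixed b hb hj]
    exact h.left.center_ne_and_distinguishable_of_fixed hB hL h.source h.left_left h.right_left
      (hQ i) (Camera.center_mem_linePoints_iff.1 (hQ j) h.right.toLin_left) (hQ b)
      (Q.distinct.ne hb.symm)

theorem center_ne_and_distinguishable (h : MovesTwoCenters B Q.cam P i j u v t s) (hab : a ≠ b)
    (hm : a = i ∨ a = j ∨ b = i ∨ b = j) :
    (P a).center ≠ (P b).center ∧ Distinguishable (Q.cam a) (Q.cam b) (P a) (P b) := by
  rcases hm with rfl | rfl | rfl | rfl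
  · exact h.center_ne_and_distinguishable_left hB hL hQ hab.symm
  · exact h.symm.center_ne_and_distinguishable_left hB hL hQ hab.symm
  · exact (h.center_ne_and_distinguishable_left hB hL hQ hab).imp Ne.symm Distinguishable.swap
  · exact (h.symm.center_ne_and_distinguishable_left hB hL hQ hab).imp Ne.symm Distinguishable.swap

theorem center_injective (h : MovesTwoCenters B Q.cam P i j u v t s) :
    Function.Injective fun l => (P l).center := by
  refine fun a b => not_imp_not.1 fun hab => ?_
  by_cases hm : a = i ∨ a = j ∨ b = i ∨ b = j
  · exact (h.center_ne_and_distinguishable hB hL hQ hab hm).1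
  · push Not at hm
    simp only [h.fixed a hm.1 hm.2.1, h.fixed b hm.2.2.1 hm.2.2.2]
    exact Q.distinct.ne hab

end MovesTwoCenters

theorem exists_movesTwoCenters {Q : CameraTuple n} {i j : Fin n} (hB : IsTwistedCubic B)
    (hij : i ≠ j) (hi : (Q.cam i).center ∈ curve B) (hj : (Q.cam j).center ∈ curve B) :
    ∃ P u v t s, MovesTwoCenters B Q.cam P i j u v t s := by
  obtain ⟨u, hu, hQu⟩ := hB.exists_real_of_center_mem hi
  obtain ⟨v, hv, hQv⟩ := hB.exists_real_of_center_mem hj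
  have huv : bracket (complexify u) (complexify v) ≠ 0 := fun h => by
    obtain ⟨c, hc⟩ := exists_eq_smul_of_bracket_eq_zero (complexify_ne_zero.2 hv) h
    refine Q.distinct.ne hij ((Camera.center_eq_iff (hB.paramMap_ne_zero _
      (complexify_ne_zero.2 hu)) hQu).2 ?_)
    rw [hc, paramMap_smul, map_smul, hQv, smul_zero]
  have hvu := bracket_ne_zero_comm.1 huv
  have hut : bracket (complexify u) (complexify (u + v)) ≠ 0 := by simpa using huv
  have hus : bracket (complexify u) (complexify (u - v)) ≠ 0 := by simpa using huv
  have hts : bracket (complexify (u + v)) (complexify (u - v)) ≠ 0 := by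
    rw [map_add, map_sub, map_sub, map_add, LinearMap.add_apply, LinearMap.add_apply, bracket_self,
      bracket_self, zero_add, add_zero, bracket_swap, sub_eq_add_neg, ← two_mul]
    exact mul_ne_zero two_ne_zero (neg_ne_zero.2 huv)
  obtain ⟨P₁, hP₁⟩ := exists_isReprojection hB hu hQu
    (complexify_ne_zero.1 (right_ne_zero_of_bracket_ne_zero hut))
  obtain ⟨P₂, hP₂⟩ := exists_isReprojection hB hv hQv
    (complexify_ne_zero.1 (right_ne_zero_of_bracket_ne_zero hus))
  refine ⟨Function.update (Function.update Q.cam j P₂) i P₁, _, _, _, _, huv, hts, hut, hus,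
    by simpa using hvu, by simpa using hvu, ?_, ?_, fun l hi hj => ?_⟩
  · rwa [Function.update_self]
  · rwa [Function.update_of_ne hij.symm, Function.update_self]
  · rw [Function.update_of_ne hi, Function.update_of_ne hj]

theorem exists_conjugate_of_two_centers_mem_curve {Q : CameraTuple n} {i j : Fin n}
    (hB : IsTwistedCubic B) (hL : IsLine L) (hQ : Q.CentersIn (linePoints L)) (hij : i ≠ j)
    (hi : (Q.cam i).center ∈ curve B) (hj : (Q.cam j).center ∈ curve B) :
    ∃ P : CameraTuple n, (∀ Y ⊆ curve B, Conjugate Q Y P Y) ∧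
      ∀ a b, a ≠ b → (a = i ∨ a = j ∨ b = i ∨ b = j) →
        Distinguishable (Q.cam a) (Q.cam b) (P.cam a) (P.cam b) := by
  obtain ⟨P, u, v, t, s, h⟩ := exists_movesTwoCenters hB hij hi hj
  obtain ⟨P, rfl⟩ : ∃ P' : CameraTuple n, P'.cam = P := ⟨⟨P, h.center_injective hB hL hQ⟩, rfl⟩
  have hD (a b) (hab : a ≠ b) (hm : a = i ∨ a = j ∨ b = i ∨ b = j) :=
    (h.center_ne_and_distinguishable hB hL hQ hab hm).2
  refine ⟨P, fun Y hY => ?_, hD⟩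
  rw [curve_eq_range hB.paramMap_ne_zero] at hY
  rw [← Set.image_preimage_eq_of_subset hY]
  exact conjugate_image (fun l z => h.haveCommonImage _ l) (hD i j hij (Or.inl rfl)) _

theorem secantLine_isNonTriviallyCritical {Q : CameraTuple n} (hn : 2 ≤ n) (hB : IsTwistedCubic B)
    (hL : IsSecantLine B L) (hQ : Q.CentersIn (linePoints L))
    (h : n ≤ 3 ∨ Q.AtMostOneCenterIn (curve B)) {Y : Set P3} (hY : Y ⊆ curve B) :
    IsNonTriviallyCritical Q Y := by
  by_cases hone : Q.AtMostOneCenterIn (curve B)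
  · obtain ⟨A, P, -, -, h⟩ := secantLine_conjugateAlong hn hB hL hQ hone
    exact h.isNonTriviallyCritical hY
  · have hn3 := h.resolve_right hone
    simp only [CameraTuple.AtMostOneCenterIn, not_forall] at hone
    obtain ⟨i, j, hi, hj, hij⟩ := hone
    obtain ⟨P, hP, hD⟩ := exists_conjugate_of_two_centers_mem_curve hB hL.1 hQ hij hi hj
    refine ⟨P, Y, hP Y hY, fun a b hab => (hD a b hab ?_).fundamentalMatrix_ne⟩
    -- Two pairs of indices below `3` meet.
    omega

theorem secantLine_isCritical {Q : CameraTuple n} (hn : 2 ≤ n) (hB : IsTwistedCubic B)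
    (hL : IsSecantLine B L) (hQ : Q.CentersIn (linePoints L)) {Y : Set P3} (hY : Y ⊆ curve B) :
    IsCritical Q Y := by
  by_cases hone : Q.AtMostOneCenterIn (curve B)
  · obtain ⟨P, X, h⟩ := secantLine_isNonTriviallyCritical hn hB hL hQ (Or.inr hone) hY
    exact ⟨P, X, h.1⟩
  · simp only [CameraTuple.AtMostOneCenterIn, not_forall] at hone
    obtain ⟨i, j, hi, hj, hij⟩ := hone
    obtain ⟨P, hP, -⟩ := exists_conjugate_of_two_centers_mem_curve hB hL.1 hQ hij hi hj
    exact ⟨P, Y, hP Y hY⟩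

end MovedCenters

end

theorem mainTheorem5 (n : ℕ) (hn : 2 ≤ n) :
    -- cameras and points on a smooth rational quartic
    (∀ A : Matrix (Fin 4) (Fin (4 + 1)) ℝ, IsSmoothRationalQuartic A →
      ∀ P : CameraTuple n, P.CentersIn (curve A) →
        (∀ X ⊆ curve A, IsNonTriviallyCritical P X) ∧
        ∃ (B : Matrix (Fin 4) (Fin (3 + 1)) ℝ) (L : Submodule ℂ (Fin 4 → ℂ)) (Q : CameraTuple n),
          IsTwistedCubic B ∧ IsLine L ∧ Disjoint (linePoints L) (curve B) ∧
          Q.CentersIn (linePoints L) ∧ ConjugateAlong P (curve A) Q (curve B)) ∧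
    -- points on a twisted cubic, cameras on a line disjoint from it
    (∀ (B : Matrix (Fin 4) (Fin (3 + 1)) ℝ) (L : Submodule ℂ (Fin 4 → ℂ)),
      IsTwistedCubic B → IsLine L → Disjoint (linePoints L) (curve B) →
      ∀ Q : CameraTuple n, Q.CentersIn (linePoints L) →
        (∀ Y ⊆ curve B, IsNonTriviallyCritical Q Y) ∧
        ∃ (A : Matrix (Fin 4) (Fin (4 + 1)) ℝ) (P : CameraTuple n),
          IsSmoothRationalQuartic A ∧ P.CentersIn (curve A) ∧
          ConjugateAlong Q (curve B) P (curve A)) ∧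
    -- cameras and points on a singular rational quartic
    (∀ A : Matrix (Fin 4) (Fin (4 + 1)) ℝ, IsSingularRationalQuartic A →
      ∀ P : CameraTuple n, P.CentersIn (curve A) →
        (∀ X ⊆ curve A, IsNonTriviallyCritical P X) ∧
        (P.CentersIn (realBranch A) →
          ∃ (B : Matrix (Fin 4) (Fin (3 + 1)) ℝ) (L : Submodule ℂ (Fin 4 → ℂ))
            (Q : CameraTuple n),
            IsTwistedCubic B ∧ IsSecantLine B L ∧ Q.CentersIn (linePoints L) ∧
            Q.AtMostOneCenterIn (curve B) ∧ ConjugateAlong P (curve A) Q (curve B))) ∧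
    -- points on a twisted cubic, cameras on a secant line
    (∀ (B : Matrix (Fin 4) (Fin (3 + 1)) ℝ) (L : Submodule ℂ (Fin 4 → ℂ)),
      IsTwistedCubic B → IsSecantLine B L →
      ∀ Q : CameraTuple n, Q.CentersIn (linePoints L) →
        (∀ Y ⊆ curve B, IsCritical Q Y) ∧
        (n ≤ 3 ∨ Q.AtMostOneCenterIn (curve B) → ∀ Y ⊆ curve B, IsNonTriviallyCritical Q Y) ∧
        (Q.AtMostOneCenterIn (curve B) →
          ∃ (A : Matrix (Fin 4) (Fin (4 + 1)) ℝ) (P : CameraTuple n),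
            IsSingularRationalQuartic A ∧ P.CentersIn (realBranch A) ∧
            ConjugateAlong Q (curve B) P (curve A))) := by
  refine ⟨fun A hA P hP => ⟨fun X hX => ?_, ?_⟩, fun B L hB hL hdisj Q hQ => ?_,
    fun A hA P hP => ⟨fun X hX => ?_, fun h => ?_⟩,
    fun B L hB hL Q hQ => ⟨fun Y hY => ?_, fun h Y hY => ?_, ?_⟩⟩
  · exact IsRationalQuartic.isNonTriviallyCritical hn hA.1 hP hX
  · exact smoothQuartic_conjugateAlong hn hA hP
  · have h := disjointLine_conjugateAlong hn hB hL hdisj hQ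
    refine ⟨fun Y hY => ?_, h⟩
    obtain ⟨A, P, -, -, hP⟩ := h
    exact hP.isNonTriviallyCritical hY
  · exact IsRationalQuartic.isNonTriviallyCritical hn hA.1 hP hX
  · exact singularQuartic_conjugateAlong hn hA fun i =>
      Camera.exists_real_of_center_mem_realBranch (h i)
  · exact secantLine_isCritical hn hB hL hQ hY
  · exact secantLine_isNonTriviallyCritical hn hB hL hQ h hY
  · exact secantLine_conjugateAlong hn hB hL hQ
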